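/- An instance of \textsc{Path Contraction with Fixed Endvertices} (PCFE) is a tuple $(G,u,v,k)$, where $G$ is a finite simple connected graph, $u,v\in V(G)$, and $k\ge 0$ is an integer, the parameter. Contracting an edge $xy$ replaces $x$ and $y$ by one new vertex adjacent to exactly the other vertices that were neighbours of $x$ or $y$ (no loops or multiple edges arise). When $G$ is turned into a graph $H$ by a sequence of edge contractions, the witness set $W(h)$ of a vertex $h\in V(H)$ is the set of vertices of $G$ contracted into $h$. The instance is a YES instance if at most $k$ edge contractions turn $G$ into a path with endvertices $u_0,v_0$ such that $u\in W(u_0)$ and $v\in W(v_0)$ (a single vertex counts as a path, with $u_0=v_0$). \textbf{Theorem.} PCFE admits a kernel with at most $3k+4$ vertices. That is, there is an algorithm which maps every instance $(G,u,v,k)$ of PCFE to an instance $(G',u',v',k')$ of PCFE such that 1. $(G,u,v,k)$ is a YES instance if and only if $(G',u',v',k')$ is a YES instance; 2. $|V(G')|\le 3k+4$, $|V(G')|\le |V(G)|$ and $k'\le k$; 3. if $u\ne v$, then $u'\ne v'$; 4. the algorithm runs in time polynomial in $|V(G)|$. Here time is counted on a random access machine with addition and truncated subtraction but no multiplication, each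 operation costing one unit; $G$ is given by its adjacency matrix, and $u$, $v$, $k$ as numbers. -/

import Mathlib

/-! ### Edge contraction -/

/-- `H` is (a copy of) the graph obtained from `G` by contracting one edge `xy`. The map `g` sends
every vertex of `G` to its image: it identifies `x` with `y` and nothing else, and two distinct
vertices of `H` are adjacent exactly if some edge of `G` joins their preimages (so neither loops nor
multiple edges arise). -/
def IsEdgeContraction {V W : Type} (G : SimpleGraph V) (H : SimpleGraph W) (g : V → W) : Prop :=
  ∃ x y : V, G.Adj x y ∧
    Function.Surjective g ∧
    (∀ a b, g a = g b ↔ a = b ∨ (a = x ∧ b = y) ∨ (a = y ∧ b = x)) ∧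
    (∀ p q, H.Adj p q ↔ p ≠ q ∧ ∃ a b, g a = p ∧ g b = q ∧ G.Adj a b)

/-- `ContractsTo G H f q`: performing `q` edge contractions, one after the other, turns `G` into
`H`; the witness set of a vertex `h` of `H` is `W(h) = {x | f x = h}`. -/
inductive ContractsTo {V : Type} (G : SimpleGraph V) :
    {W : Type} → SimpleGraph W → (V → W) → ℕ → Prop
  | refl : ContractsTo G G id 0
  | step {W W' : Type} {H : SimpleGraph W} {H' : SimpleGraph W'} {f : V → W} {g : W → W'} {q : ℕ} :
      ContractsTo G H f q → IsEdgeContraction H H' g → ContractsTo G H' (g ∘ f) (q + 1)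

/-- The whole graph `H` is a path with endvertices `a` and `b` (a single vertex counts as a path,
with `a = b`). -/
def IsPathBetween {W : Type} (H : SimpleGraph W) (a b : W) : Prop :=
  ∃ (m : ℕ) (e : H ≃g SimpleGraph.pathGraph (m + 1)), e a = 0 ∧ e b = Fin.last m

/-! ### The problem Path Contraction with Fixed Endvertices -/

/-- An instance `(G, u, v, k)`: a connected graph on the vertex set `{0, …, n - 1}`, two vertices and
the parameter. -/
structure PCFEInstance where
  n : ℕ
  G : SimpleGraph (Fin n)
  connected : G.Connected
  u : Fin n
  v : Fin n
  k : ℕ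

/-- `(G, u, v, k)` is a YES instance: at most `k` edge contractions turn `G` into a path between two
vertices `u₀` and `v₀` with `u ∈ W(u₀)` and `v ∈ W(v₀)`. -/
def PCFEInstance.IsYes (I : PCFEInstance) : Prop :=
  ∃ (W : Type) (H : SimpleGraph W) (f : Fin I.n → W) (q : ℕ) (u₀ v₀ : W),
    q ≤ I.k ∧ ContractsTo I.G H f q ∧ IsPathBetween H u₀ v₀ ∧ f I.u = u₀ ∧ f I.v = v₀

/-! ### The machine model

A random access machine in structured form. A machine has number registers and two-dimensional
arrays of natural numbers, all addressed by natural numbers; a program names finitely many registers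
and arrays. The operations are addition, truncated subtraction, (indirect) array access, branching
and looping; there is no multiplication, so that charging one unit for each operation is polynomially
equivalent to Turing machine time. -/

/-- The contents of all registers (`reg r`) and of all array cells (`arr a i j`). -/
structure RamState where
  reg : ℕ → ℕ
  arr : ℕ → ℕ → ℕ → ℕ

/-- Assign the value `x` to the register `r`. -/
def RamState.setReg (s : RamState) (r x : ℕ) : RamState where
  reg := fun r' => if r' = r then x else s.reg r'
  arr := s.arr

/-- Assign the value `x` to the cell `(i, j)` of the array `a`. -/
def RamState.setArr (s : RamState) (a i j x : ℕ) : RamState where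
  reg := s.reg
  arr := fun a' i' j' => if a' = a ∧ i' = i ∧ j' = j then x else s.arr a' i' j'

inductive RamExpr where
  | const (c : ℕ)
  | reg (r : ℕ)
  | arr (a : ℕ) (i j : RamExpr)
  | add (e₁ e₂ : RamExpr)
  | sub (e₁ e₂ : RamExpr)

/-- The value of an expression; `sub` is truncated subtraction. -/
def RamExpr.eval (s : RamState) : RamExpr → ℕ
  | const c => c
  | reg r => s.reg r
  | arr a i j => s.arr a (i.eval s) (j.eval s)
  | add e₁ e₂ => e₁.eval s + e₂.eval s
  | sub e₁ e₂ => e₁.eval s - e₂.eval s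

/-- The time for evaluating an expression: one unit for each constant, register or array access and
arithmetic operation. -/
def RamExpr.cost : RamExpr → ℕ
  | const _ => 1
  | reg _ => 1
  | arr _ i j => i.cost + j.cost + 1
  | add e₁ e₂ => e₁.cost + e₂.cost + 1
  | sub e₁ e₂ => e₁.cost + e₂.cost + 1

/-- Programs. A test succeeds if the value of its expression is nonzero. -/
inductive RamProg where
  | skip
  | setReg (r : ℕ) (e : RamExpr)
  | setArr (a : ℕ) (i j e : RamExpr)
  | seq (p₁ p₂ : RamProg)
  | branch (e : RamExpr) (p₁ p₂ : RamProg)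
  | loop (e : RamExpr) (p : RamProg)

/-- `RamExec p s s' t`: started in the state `s`, the program `p` halts after exactly `t` time units,
in the state `s'`. -/
inductive RamExec : RamProg → RamState → RamState → ℕ → Prop
  | skip (s : RamState) : RamExec .skip s s 1
  | setReg (s : RamState) (r : ℕ) (e : RamExpr) :
      RamExec (.setReg r e) s (s.setReg r (e.eval s)) (e.cost + 1)
  | setArr (s : RamState) (a : ℕ) (i j e : RamExpr) :
      RamExec (.setArr a i j e) s (s.setArr a (i.eval s) (j.eval s) (e.eval s))
        (i.cost + j.cost + e.cost + 1)
  | seq {s s' s'' : RamState} {p₁ p₂ : RamProg} {t₁ t₂ : ℕ} :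
      RamExec p₁ s s' t₁ → RamExec p₂ s' s'' t₂ → RamExec (.seq p₁ p₂) s s'' (t₁ + t₂)
  | branch_true {s s' : RamState} {e : RamExpr} {p₁ p₂ : RamProg} {t : ℕ} :
      e.eval s ≠ 0 → RamExec p₁ s s' t → RamExec (.branch e p₁ p₂) s s' (e.cost + 1 + t)
  | branch_false {s s' : RamState} {e : RamExpr} {p₁ p₂ : RamProg} {t : ℕ} :
      e.eval s = 0 → RamExec p₂ s s' t → RamExec (.branch e p₁ p₂) s s' (e.cost + 1 + t)
  | loop_step {s s' s'' : RamState} {e : RamExpr} {p : RamProg} {t₁ t₂ : ℕ} :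
      e.eval s ≠ 0 → RamExec p s s' t₁ → RamExec (.loop e p) s' s'' t₂ →
        RamExec (.loop e p) s s'' (e.cost + 1 + t₁ + t₂)
  | loop_exit {s : RamState} {e : RamExpr} {p : RamProg} :
      e.eval s = 0 → RamExec (.loop e p) s s (e.cost + 1)

/-! ### Encoding of instances

Registers `0, 1, 2, 3` hold `n, u, v, k`, and array `0` holds the adjacency matrix of `G`. -/

/-- The entry in row `i` and column `j` of the adjacency matrix (`0` outside the matrix). -/
noncomputable def PCFEInstance.entry (I : PCFEInstance) (i j : ℕ) : ℕ :=
  open Classical in if ∃ a b : Fin I.n, a.val = i ∧ b.val = j ∧ I.G.Adj a b then 1 else 0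

/-- The initial state on input `I`: everything that does not hold the input is `0`. -/
noncomputable def PCFEInstance.input (I : PCFEInstance) : RamState where
  reg := fun r =>
    if r = 0 then I.n else if r = 1 then I.u else if r = 2 then I.v else if r = 3 then I.k else 0
  arr := fun a i j => if a = 0 then I.entry i j else 0

/-- The state `s` holds the instance `J` as output; other registers and cells are irrelevant. -/
def PCFEInstance.IsOutput (J : PCFEInstance) (s : RamState) : Prop :=
  s.reg 0 = J.n ∧ s.reg 1 = J.u ∧ s.reg 2 = J.v ∧ s.reg 3 = J.k ∧
    ∀ i j : ℕ, i < J.n → j < J.n → s.arr 0 i j = J.entry i j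

/-! ### Kernelization -/

/-- The program `p` is a kernelization for PCFE all of whose kernels have at most `bound k` vertices:
it runs in time polynomial in the number of vertices of the input, and it maps every instance
`(G, u, v, k)` to an equivalent instance `(G', u', v', k')` with `k' ≤ k`, where `G'` has at most
`bound k` vertices, and no more vertices than `G`; moreover distinct prescribed vertices stay
distinct, so that `p` is also a kernelization for the problem restricted to instances with
`u ≠ v`. -/
def IsPCFEKernelization (p : RamProg) (bound : ℕ → ℕ) : Prop :=
  ∃ time : Polynomial ℕ, ∀ I : PCFEInstance, ∃ (J : PCFEInstance) (s : RamState) (t : ℕ),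
    RamExec p I.input s t ∧ t ≤ time.eval I.n ∧ J.IsOutput s ∧
    (I.IsYes ↔ J.IsYes) ∧
    J.n ≤ bound I.k ∧ J.k ≤ I.k ∧ J.n ≤ I.n ∧ (I.u ≠ I.v → J.u ≠ J.v)

open Relation

/-! ### Chains -/

/-! A sequence of contractions turning G into a path with m + 1 vertices is the same thing as a
levelling: a function f from V(G) to {0, …, m} with f u = 0 and f v = m that changes by at most one
along every edge and has connected fibres. Every contraction loses one vertex, so its cost is n - (m
+ 1), and `PCFEInstance.isYes_iff` replaces contraction sequences by such functions.

The only reduction rule contracts an edge xy that is the sole edge leaving some set S with u in S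
and v not in S, unless x = u and y = v (this exception keeps u and v distinct). The parameter stays
the same. A levelling of G loses at most one level under the contraction, by merging the levels of x
and y (`ContractsEdge.exists_isLevelling`). Conversely, pull a levelling of the contracted graph
back to G. Then x and y share a level, all lower levels lie in S and all higher ones outside S
(`IsEdgeCut.mem_of_lt`), so this single level can be split along S into two connected levels
(`IsEdgeCut.split`). In both directions n changes by one and m by enough to keep the budget.

If the rule no longer applies, two consecutive levels cannot both be singletons unless n = 2, so
they contain at least three vertices together. Summing over consecutive pairs bounds n by 3k + 4 for
YES instances; larger instances are replaced by a fixed NO instance, the triangle.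

The algorithm keeps the adjacency matrix at its original size n, and every loop runs exactly n
times, which makes the running time a polynomial read off from the program text. Separating edges
are found by deleting one arc and computing reachability. -/

theorem exists_crossing {α : Type} {r : α → α → Prop} {P : α → Prop} {a b : α}
    (h : ReflTransGen r a b) (ha : P a) (hb : ¬ P b) : ∃ c d, r c d ∧ P c ∧ ¬ P d := by
  induction h with
  | refl => exact absurd ha hb
  | @tail c d _ hcd ih =>
    by_cases hc : P c
    · exact ⟨c, d, hcd, hc, hb⟩
    · exact ih hc

theorem SimpleGraph.Connected.reflTransGen {V : Type} {G : SimpleGraph V} (hG : G.Connected)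
    (a b : V) : ReflTransGen G.Adj a b :=
  (SimpleGraph.reachable_iff_reflTransGen a b).1 (hG.preconnected a b)

theorem chain_mono {α : Type} {r r' : α → α → Prop} {a b : α} (h : ReflTransGen r a b)
    (himp : ∀ c d, r c d → r' c d) : ReflTransGen r' a b := by
  induction h with
  | refl => exact .refl
  | tail _ hcd ih => exact ih.tail (himp _ _ hcd)

/-! ### Quotients by connected partitions. -/

/-- Adjacent vertices of the same fibre of `f`. -/
def FiberAdj {V W : Type} (G : SimpleGraph V) (f : V → W) (a b : V) : Prop :=
  G.Adj a b ∧ f a = f b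

/-- All fibres of `f` induce connected subgraphs of `G`. -/
def FibersConnected {V W : Type} (G : SimpleGraph V) (f : V → W) : Prop :=
  ∀ a b, f a = f b → ReflTransGen (FiberAdj G f) a b

/-- `H` is the quotient of `G` by the fibres of the surjection `f`. -/
structure IsQuotient {V W : Type} (G : SimpleGraph V) (H : SimpleGraph W) (f : V → W) : Prop where
  surj : Function.Surjective f
  adj_iff : ∀ p q, H.Adj p q ↔ p ≠ q ∧ ∃ a b, f a = p ∧ f b = q ∧ G.Adj a b
  fibers : FibersConnected G f

/-- Each edge of a chain in `H` lifts to an edge of `G`; consecutive lifts are linked inside the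
connected fibres of `f`. -/
theorem IsQuotient.fibers_comp {V W X : Type} {G : SimpleGraph V} {H : SimpleGraph W} {f : V → W}
    (h : IsQuotient G H f) {g : W → X} (hg : FibersConnected H g) : FibersConnected G (g ∘ f) := by
  have key : ∀ p q, ReflTransGen (FiberAdj H g) p q → ∀ a b, f a = p → f b = q →
      ReflTransGen (FiberAdj G (g ∘ f)) a b := by
    intro p q hpq
    have inner : ∀ a b, f a = f b → ReflTransGen (FiberAdj G (g ∘ f)) a b := fun a b hab =>
      chain_mono (h.fibers a b hab) fun c d hcd => ⟨hcd.1, congrArg g hcd.2⟩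
    induction hpq with
    | refl => exact fun a b ha hb => inner a b (ha.trans hb.symm)
    | @tail q q' _ hqq' ih =>
      intro a b ha hb
      obtain ⟨_, c, d, hc, hd, hcd⟩ := (h.adj_iff q q').1 hqq'.1
      refine ((ih a c ha hc).tail ⟨hcd, ?_⟩).trans (inner d b (hd.trans hb.symm))
      simp only [Function.comp, hc, hd]
      exact hqq'.2
  exact fun a b hab => key _ _ (hg _ _ hab) a b rfl rfl

theorem IsEdgeContraction.isQuotient {V W : Type} {G : SimpleGraph V} {H : SimpleGraph W}
    {g : V → W} (h : IsEdgeContraction G H g) : IsQuotient G H g := by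
  obtain ⟨x, y, hxy, hs, hk, ha⟩ := h
  refine ⟨hs, ha, fun a b hab => ?_⟩
  have hgxy : g x = g y := (hk x y).2 (Or.inr (Or.inl ⟨rfl, rfl⟩))
  rcases (hk a b).1 hab with rfl | ⟨rfl, rfl⟩ | ⟨rfl, rfl⟩
  · exact .refl
  · exact .single ⟨hxy, hgxy⟩
  · exact .single ⟨hxy.symm, hgxy.symm⟩

theorem IsEdgeContraction.card {V W : Type} [Finite V] {G : SimpleGraph V} {H : SimpleGraph W}
    {g : V → W} (h : IsEdgeContraction G H g) : Nat.card W + 1 = Nat.card V := by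
  obtain ⟨x, y, hxy, hs, hk, -⟩ := h
  classical
  have e : {a : V // a ≠ y} ≃ W := by
    refine Equiv.ofBijective (fun a => g a.1) ⟨?_, ?_⟩
    · rintro ⟨a, ha⟩ ⟨b, hb⟩ hab
      rcases (hk a b).1 hab with rfl | ⟨rfl, rfl⟩ | ⟨rfl, rfl⟩
      · rfl
      · exact absurd rfl hb
      · exact absurd rfl ha
    · intro w
      obtain ⟨a, rfl⟩ := hs w
      by_cases ha : a = y
      · exact ⟨⟨x, hxy.ne⟩, (hk x a).2 (Or.inr (Or.inl ⟨rfl, ha⟩))⟩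
      · exact ⟨⟨a, ha⟩, rfl⟩
  have := Fintype.ofFinite V
  rw [← Nat.card_congr e, Nat.card_eq_fintype_card, Nat.card_eq_fintype_card,
    Fintype.card_subtype_compl, Fintype.card_subtype_eq]
  have : 0 < Fintype.card V := Fintype.card_pos_iff.2 ⟨x⟩
  omega

/-- The order of the contractions is forgotten: only the partition matters, and the number of
contractions is the drop in the number of vertices. -/
theorem ContractsTo.isQuotient_and_card {V W : Type} [Finite V] {G : SimpleGraph V}
    {H : SimpleGraph W} {f : V → W} {q : ℕ} (h : ContractsTo G H f q) :
    IsQuotient G H f ∧ Nat.card W + q = Nat.card V := by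
  induction h with
  | refl =>
    refine ⟨⟨Function.surjective_id, fun p q => ⟨fun h => ⟨h.ne, p, q, rfl, rfl, h⟩, ?_⟩, ?_⟩, rfl⟩
    · rintro ⟨_, a, b, rfl, rfl, h⟩
      exact h
    · rintro a b rfl
      exact .refl
  | @step W W' H H' f g q _ hg ih =>
    obtain ⟨hq, hc⟩ := ih
    have : Finite W := Finite.of_surjective f hq.surj
    have hg' := hg.isQuotient
    refine ⟨⟨hg'.surj.comp hq.surj, fun p p' => ?_, hq.fibers_comp hg'.fibers⟩, ?_⟩
    · rw [hg'.adj_iff]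
      refine and_congr_right fun hne => ⟨?_, ?_⟩
      · rintro ⟨a, b, rfl, rfl, hab⟩
        obtain ⟨_, c, d, rfl, rfl, hcd⟩ := (hq.adj_iff a b).1 hab
        exact ⟨c, d, rfl, rfl, hcd⟩
      · rintro ⟨c, d, rfl, rfl, hcd⟩
        refine ⟨f c, f d, rfl, rfl, (hq.adj_iff _ _).2 ⟨fun h => hne ?_, c, d, rfl, rfl, hcd⟩⟩
        simp only [Function.comp, h]
    · have := hg.card
      omega

/-- The contraction is modelled by deleting `q` and sending it to `p`; since `h` agrees on both, its
restriction is the factor `h'`. -/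
theorem exists_isEdgeContraction_of_adj {W X : Type} {H : SimpleGraph W} {h : W → X} {p q : W}
    (hpq : H.Adj p q) (heq : h p = h q) :
    ∃ (W' : Type) (H' : SimpleGraph W') (g : W → W') (h' : W' → X),
      IsEdgeContraction H H' g ∧ h' ∘ g = h := by
  classical
  let g : W → {w : W // w ≠ q} := fun w => if hw : w = q then ⟨p, hpq.ne⟩ else ⟨w, hw⟩
  have gv : ∀ w, (g w).1 = if w = q then p else w := by
    intro w
    by_cases hw : w = q <;> simp [g, hw]
  refine ⟨{w : W // w ≠ q},
    { Adj := fun a b => a ≠ b ∧ ∃ c d, g c = a ∧ g d = b ∧ H.Adj c d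
      symm := ⟨?_⟩, loopless := ⟨?_⟩ }, g, fun w => h w.1,
    ⟨p, q, hpq, ?_, ?_, fun _ _ => Iff.rfl⟩, ?_⟩
  · rintro a b ⟨hne, c, d, hc, hd, hcd⟩
    exact ⟨hne.symm, d, c, hd, hc, hcd.symm⟩
  · rintro a ⟨hne, _⟩
    exact hne rfl
  · rintro ⟨w, hw⟩
    exact ⟨w, by simp [g, hw]⟩
  · intro a b
    have := hpq.ne
    rw [Subtype.ext_iff, gv, gv]
    by_cases ha : a = q <;> by_cases hb : b = q <;> grind
  · funext w
    simp only [Function.comp, gv]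
    split_ifs with hw
    · rw [heq, hw]
    · rfl

/-- A connected partition can be reached by edge contractions. -/
theorem exists_contractsTo {V X : Type} [Finite V] {G : SimpleGraph V} {f : V → X}
    (hf : FibersConnected G f) :
    ∃ (W : Type) (H : SimpleGraph W) (g : V → W) (h : W → X) (q : ℕ),
      ContractsTo G H g q ∧ h ∘ g = f ∧ Function.Injective h := by
  have key : ∀ (n : ℕ) (W : Type) (H : SimpleGraph W) (g : V → W) (h : W → X) (q : ℕ),
      Nat.card W = n → ContractsTo G H g q → h ∘ g = f →
      ∃ (W : Type) (H : SimpleGraph W) (g : V → W) (h : W → X) (q : ℕ),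
        ContractsTo G H g q ∧ h ∘ g = f ∧ Function.Injective h := by
    intro n
    induction n using Nat.strong_induction_on with
    | _ n ih =>
      intro W H g h q hn hc hhg
      by_cases hinj : Function.Injective h
      · exact ⟨W, H, g, h, q, hc, hhg, hinj⟩
      · have hq := hc.isQuotient_and_card.1
        have : Finite W := Finite.of_surjective g hq.surj
        simp only [Function.Injective, not_forall] at hinj
        obtain ⟨w, w', hww', hne⟩ := hinj
        obtain ⟨a, rfl⟩ := hq.surj w
        obtain ⟨b, rfl⟩ := hq.surj w'
        have hfab : f a = f b := by rw [← hhg]; exact hww'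
        -- Two vertices of `H` with the same value under `h` lie over one connected fibre of `f`, so
        -- a chain between them leaves the witness set of the first. The crossing edge can be
        -- contracted without leaving that fibre.
        obtain ⟨c, d, hcd, hgc, hgd⟩ := exists_crossing (P := fun z => g z = g a) (hf a b hfab) rfl
          (fun h => hne h.symm)
        have hne' : g c ≠ g d := fun h => hgd (h.symm.trans hgc)
        have hadj : H.Adj (g c) (g d) := (hq.adj_iff _ _).2 ⟨hne', c, d, rfl, rfl, hcd.1⟩
        have heq : h (g c) = h (g d) := by
          have := hcd.2
          rwa [← hhg] at this
        obtain ⟨W', H', g', h', hg', hh'⟩ := exists_isEdgeContraction_of_adj hadj heq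
        have hcard := hg'.card
        exact ih (Nat.card W') (by omega) W' H' (g' ∘ g) h' (q + 1) rfl (hc.step hg')
          (by rw [← Function.comp_assoc, hh', hhg])
  exact key _ V G id f 0 rfl .refl rfl

/-! ### Level functions -/

/-- `f` numbers the witness sets of a contraction of `G` to a path on `m + 1` vertices whose first
witness set contains `u` and whose last witness set contains `v`. -/
structure IsLevelling {V : Type} (G : SimpleGraph V) (u v : V) (m : ℕ) (f : V → ℕ) : Prop where
  first : f u = 0
  last : f v = m
  le : ∀ a, f a ≤ m
  step : ∀ a b, G.Adj a b → f a ≤ f b + 1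
  fibers : FibersConnected G f

/-- A walk from `u` to `v` must leave the levels up to `i`, and an edge climbs by at most one. In
particular no level is empty. -/
theorem IsLevelling.exists_adj {V : Type} {G : SimpleGraph V} {u v : V} {m : ℕ} {f : V → ℕ}
    (h : IsLevelling G u v m f) (hG : G.Connected) {i : ℕ} (hi : i < m) :
    ∃ a b, G.Adj a b ∧ f a = i ∧ f b = i + 1 := by
  obtain ⟨a, b, hab, ha, hb⟩ := exists_crossing (P := fun z => f z ≤ i) (hG.reflTransGen u v)
    (by simp only [h.first, Nat.zero_le]) (by simp only [h.last]; omega)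
  have := h.step b a hab.symm
  exact ⟨a, b, hab, by omega, by omega⟩

theorem IsLevelling.exists_eq {V : Type} {G : SimpleGraph V} {u v : V} {m : ℕ} {f : V → ℕ}
    (h : IsLevelling G u v m f) (hG : G.Connected) {i : ℕ} (hi : i ≤ m) : ∃ a, f a = i := by
  rcases hi.lt_or_eq with hi | rfl
  · obtain ⟨a, _, _, ha, _⟩ := h.exists_adj hG hi
    exact ⟨a, ha⟩
  · exact ⟨v, h.last⟩

theorem IsLevelling.reverse {V : Type} {G : SimpleGraph V} {u v : V} {m : ℕ} {f : V → ℕ}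
    (h : IsLevelling G u v m f) : IsLevelling G v u m (fun a => m - f a) where
  first := by simp [h.last]
  last := by simp [h.first]
  le a := by simp
  step a b hab := by have := h.step b a hab.symm; omega
  fibers a b hab := by
    have ha := h.le a
    have hb := h.le b
    exact chain_mono (h.fibers a b (by simp only at hab; omega)) fun c d hcd =>
      ⟨hcd.1, by simp only [hcd.2]⟩

theorem PCFEInstance.isYes_iff (I : PCFEInstance) :
    I.IsYes ↔ ∃ m f, IsLevelling I.G I.u I.v m f ∧ I.n ≤ m + 1 + I.k := by
  constructor
  · rintro ⟨W, H, f, q, u₀, v₀, hqk, hc, ⟨m, e, hu, hv⟩, rfl, rfl⟩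
    obtain ⟨hq, hcard⟩ := hc.isQuotient_and_card
    refine ⟨m, fun a => (e (f a)).val, ⟨by simp [hu], by simp [hv], fun a => by omega, ?_, ?_⟩, ?_⟩
    · intro a b hab
      by_cases hne : f a = f b
      · simp [hne]
      · have : H.Adj (f a) (f b) := (hq.adj_iff _ _).2 ⟨hne, a, b, rfl, rfl, hab⟩
        rw [← e.map_adj_iff, SimpleGraph.pathGraph_adj] at this
        omega
    · intro a b hab
      have hab' : f a = f b := e.injective (Fin.ext hab)
      exact chain_mono (hq.fibers a b hab') fun c d hcd => ⟨hcd.1, by simp only [hcd.2]⟩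
    · rw [Nat.card_congr e.toEquiv] at hcard
      simp only [Nat.card_eq_fintype_card, Fintype.card_fin] at hcard
      omega
  · rintro ⟨m, f, hf, hn⟩
    let F : Fin I.n → Fin (m + 1) := fun a => ⟨f a, Nat.lt_succ_of_le (hf.le a)⟩
    have hF : FibersConnected I.G F := fun a b hab =>
      chain_mono (hf.fibers a b (congrArg Fin.val hab)) fun c d hcd => ⟨hcd.1, Fin.ext hcd.2⟩
    obtain ⟨W, H, g, h, q, hc, hhg, hinj⟩ := exists_contractsTo hF
    obtain ⟨hq, hcard⟩ := hc.isQuotient_and_card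
    have hval : ∀ a, (h (g a)).val = f a := fun a => congrArg Fin.val (congrFun hhg a)
    have hsurj : Function.Surjective h := by
      intro i
      obtain ⟨a, ha⟩ := hf.exists_eq I.connected (Nat.le_of_lt_succ i.2)
      exact ⟨g a, Fin.ext ((hval a).trans ha)⟩
    let e : W ≃ Fin (m + 1) := Equiv.ofBijective h ⟨hinj, hsurj⟩
    refine ⟨W, H, g, q, g I.u, g I.v, ?_, hc, ⟨m, ⟨e, ?_⟩, ?_, ?_⟩, rfl, rfl⟩
    · rw [Nat.card_congr e] at hcard
      simp only [Nat.card_eq_fintype_card, Fintype.card_fin] at hcard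
      omega
    · intro p p'
      change (SimpleGraph.pathGraph (m + 1)).Adj (h p) (h p') ↔ _
      rw [SimpleGraph.pathGraph_adj, hq.adj_iff]
      constructor
      · intro hpp
        have main : ∀ p p' : W, (h p).val + 1 = (h p').val →
            ∃ a b, g a = p ∧ g b = p' ∧ I.G.Adj a b := by
          intro p p' hpp
          obtain ⟨a, b, hab, ha, hb⟩ := hf.exists_adj I.connected (i := (h p).val) (by omega)
          exact ⟨a, b, hinj (Fin.ext ((hval a).trans ha)),
            hinj (Fin.ext ((hval b).trans (hb.trans hpp))), hab⟩
        refine ⟨fun hh => by subst hh; omega, ?_⟩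
        rcases hpp with hpp | hpp
        · exact main _ _ hpp
        · obtain ⟨a, b, ha, hb, hab⟩ := main _ _ hpp
          exact ⟨b, a, hb, ha, hab.symm⟩
      · rintro ⟨hne, a, b, rfl, rfl, hab⟩
        have h1 := hf.step a b hab
        have h2 := hf.step b a hab.symm
        have h3 : (h (g a)).val ≠ (h (g b)).val := fun hh => hne (hinj (Fin.ext hh))
        rw [hval, hval] at *
        omega
    · exact Fin.ext ((hval _).trans hf.first)
    · exact Fin.ext ((hval _).trans hf.last)

/-! ### Separating edges -/

/-- `S` contains `u` but not `v`, and `xy` is the only edge leaving `S`. -/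
structure IsEdgeCut {V : Type} (G : SimpleGraph V) (u v x y : V) (S : Set V) : Prop where
  left : u ∈ S
  right : v ∉ S
  cross : ∀ a b, G.Adj a b → a ∈ S → b ∉ S → a = x ∧ b = y

theorem IsEdgeCut.compl {V : Type} {G : SimpleGraph V} {u v x y : V} {S : Set V}
    (h : IsEdgeCut G u v x y S) : IsEdgeCut G v u y x Sᶜ where
  left := h.right
  right := fun h' => h' h.left
  cross a b hab ha hb := (h.cross b a hab.symm (not_not.1 hb) ha).symm

/-- Induction on the level. The only edge leaving `S` starts at `x`, on a higher level, so a
connected level below that of `x` cannot leave `S`, nor can an edge from such a level to the next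
one. Level `0` starts at `u`, in `S`. -/
theorem IsEdgeCut.mem_of_lt {V : Type} {G : SimpleGraph V} {u v x y : V} {S : Set V}
    (h : IsEdgeCut G u v x y S) (hG : G.Connected) {m : ℕ} {f : V → ℕ}
    (hf : IsLevelling G u v m f) (a : V) (ha : f a < f x) : a ∈ S := by
  have hle := hf.le x
  have key : ∀ i, i < f x → ∀ a, f a = i → a ∈ S := by
    intro i
    induction i with
    | zero =>
      intro hi a ha
      by_contra haS
      obtain ⟨c, d, hcd, ⟨hcS, hc⟩, hd⟩ := exists_crossing (P := fun z => z ∈ S ∧ f z = 0)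
        (hf.fibers u a (hf.first.trans ha.symm)) ⟨h.left, hf.first⟩ (fun h => haS h.1)
      have := h.cross c d hcd.1 hcS (fun hdS => hd ⟨hdS, by rw [← hcd.2, hc]⟩)
      rw [this.1] at hc
      omega
    | succ i ih =>
      intro hi a ha
      obtain ⟨c, d, hcd, hc, hd⟩ := hf.exists_adj hG (i := i) (by omega)
      have hdS : d ∈ S := by
        by_contra hdS
        have := h.cross c d hcd (ih (by omega) c hc) hdS
        rw [this.1] at hc
        omega
      by_contra haS
      obtain ⟨c', d', hcd', ⟨hcS, hc'⟩, hd'⟩ := exists_crossing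
        (P := fun z => z ∈ S ∧ f z = i + 1) (hf.fibers d a (hd.trans ha.symm)) ⟨hdS, hd⟩
        (fun h => haS h.1)
      have := h.cross c' d' hcd'.1 hcS (fun hdS => hd' ⟨hdS, by rw [← hcd'.2, hc']⟩)
      rw [this.1] at hc'
      omega
  exact key _ ha a rfl

/-! ### Levellings under the contraction of an edge. -/

/-- `g` turns `G` into `H` by contracting the edge `xy`. -/
structure ContractsEdge {V W : Type} (G : SimpleGraph V) (H : SimpleGraph W) (g : V → W)
    (x y : V) : Prop where
  adj : G.Adj x y
  surj : Function.Surjective g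
  eq_iff : ∀ a b, g a = g b ↔ a = b ∨ (a = x ∧ b = y) ∨ (a = y ∧ b = x)
  adj_iff : ∀ p q, H.Adj p q ↔ p ≠ q ∧ ∃ a b, g a = p ∧ g b = q ∧ G.Adj a b

theorem ContractsEdge.isQuotient {V W : Type} {G : SimpleGraph V} {H : SimpleGraph W}
    {g : V → W} {x y : V} (h : ContractsEdge G H g x y) : IsQuotient G H g :=
  IsEdgeContraction.isQuotient ⟨x, y, h.adj, h.surj, h.eq_iff, h.adj_iff⟩

theorem IsQuotient.connected {V W : Type} {G : SimpleGraph V} {H : SimpleGraph W} {g : V → W}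
    (h : IsQuotient G H g) (hG : G.Connected) : H.Connected := by
  have key : ∀ a b, ReflTransGen G.Adj a b → ReflTransGen H.Adj (g a) (g b) := by
    intro a b hab
    induction hab with
    | refl => exact .refl
    | @tail c d _ hcd ih =>
      by_cases hne : g c = g d
      · rwa [← hne]
      · exact ih.tail ((h.adj_iff _ _).2 ⟨hne, c, d, rfl, rfl, hcd⟩)
  obtain ⟨a⟩ := hG.nonempty
  have : Nonempty W := ⟨g a⟩
  refine ⟨fun p q => ?_⟩
  obtain ⟨a, rfl⟩ := h.surj p
  obtain ⟨b, rfl⟩ := h.surj q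
  exact (SimpleGraph.reachable_iff_reflTransGen _ _).2 (key a b (hG.reflTransGen a b))

theorem IsLevelling.descend {V W : Type} {G : SimpleGraph V} {H : SimpleGraph W} {g : V → W}
    (h : IsQuotient G H g) {u v : V} {m : ℕ} {f : V → ℕ} (hf : IsLevelling G u v m f)
    (hg : ∀ a b, g a = g b → f a = f b) : ∃ f', IsLevelling H (g u) (g v) m f' := by
  obtain ⟨s, hs⟩ := h.surj.hasRightInverse
  have hv : ∀ a, f (s (g a)) = f a := fun a => hg _ _ (hs (g a))
  refine ⟨fun w => f (s w), by rw [hv, hf.first], by rw [hv, hf.last], fun w => hf.le _, ?_, ?_⟩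
  · intro p q hpq
    obtain ⟨_, a, b, rfl, rfl, hab⟩ := (h.adj_iff p q).1 hpq
    simpa only [hv] using hf.step a b hab
  · have key : ∀ a b, ReflTransGen (FiberAdj G f) a b →
        ReflTransGen (FiberAdj H fun w => f (s w)) (g a) (g b) := by
      intro a b hab
      induction hab with
      | refl => exact .refl
      | @tail c d _ hcd ih =>
        by_cases hne : g c = g d
        · rwa [← hne]
        · exact ih.tail ⟨(h.adj_iff _ _).2 ⟨hne, c, d, rfl, rfl, hcd.1⟩, by simpa only [hv] using hcd.2⟩
    intro p q hpq
    have := key _ _ (hf.fibers _ _ hpq)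
    rwa [hs, hs] at this

/-- The two levels are united; the edge `xy` joins them, so the union is connected. -/
theorem IsLevelling.merge {V : Type} {G : SimpleGraph V} {u v x y : V} {m : ℕ} {f : V → ℕ}
    (hf : IsLevelling G u v m f) (hxy : G.Adj x y) (hlt : f x + 1 = f y) :
    IsLevelling G u v (m - 1) (fun a => if f a ≤ f x then f a else f a - 1) := by
  have hx := hf.le x
  have hy := hf.le y
  refine ⟨by simp [hf.first], ?_, fun a => ?_, fun a b hab => ?_, fun a b hab => ?_⟩
  · simp only [hf.last]
    split_ifs <;> omega
  · have := hf.le a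
    split_ifs <;> omega
  · have := hf.step a b hab
    split_ifs <;> omega
  · have same : ∀ a b, f a = f b →
        ReflTransGen (FiberAdj G fun a => if f a ≤ f x then f a else f a - 1) a b := fun a b hab =>
      chain_mono (hf.fibers a b hab) fun c d hcd => ⟨hcd.1, by simp only [hcd.2]⟩
    have hval : (if f x ≤ f x then f x else f x - 1) = (if f y ≤ f x then f y else f y - 1) := by
      split_ifs <;> omega
    by_cases h : f a = f b
    · exact same a b h
    · have : (f a = f x ∧ f b = f y) ∨ (f a = f y ∧ f b = f x) := by
        split_ifs at hab <;> omega
      rcases this with ⟨ha, hb⟩ | ⟨ha, hb⟩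
      · exact ((same a x ha).tail ⟨hxy, hval⟩).trans (same y b hb.symm)
      · exact ((same a y ha).tail ⟨hxy.symm, hval.symm⟩).trans (same x b hb.symm)

/-- The ends of the edge lie on equal or consecutive levels. After merging, if needed, they agree
and the levelling factors through `g`. -/
theorem ContractsEdge.exists_isLevelling {V W : Type} {G : SimpleGraph V} {H : SimpleGraph W}
    {g : V → W} {x y u v : V} (h : ContractsEdge G H g x y) {m : ℕ} {f : V → ℕ}
    (hf : IsLevelling G u v m f) :
    ∃ m' f', IsLevelling H (g u) (g v) m' f' ∧ m ≤ m' + 1 := by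
  obtain ⟨m', f', hf', hm, heq⟩ : ∃ m' f', IsLevelling G u v m' f' ∧ m ≤ m' + 1 ∧ f' x = f' y := by
    have h1 := hf.step x y h.adj
    have h2 := hf.step y x h.adj.symm
    rcases lt_trichotomy (f x) (f y) with hlt | heq | hlt
    · refine ⟨_, _, hf.merge h.adj (by omega), by omega, ?_⟩
      split_ifs <;> omega
    · exact ⟨m, f, hf, by omega, heq⟩
    · refine ⟨_, _, hf.merge h.adj.symm (by omega), by omega, ?_⟩
      split_ifs <;> omega
  obtain ⟨f'', hf''⟩ := hf'.descend h.isQuotient fun a b hab => by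
    rcases (h.eq_iff a b).1 hab with rfl | ⟨rfl, rfl⟩ | ⟨rfl, rfl⟩
    · rfl
    · exact heq
    · exact heq.symm
  exact ⟨m', f'', hf'', hm⟩

theorem IsLevelling.comp {V W : Type} {G : SimpleGraph V} {H : SimpleGraph W} {g : V → W}
    (h : IsQuotient G H g) {u v : V} {m : ℕ} {f : W → ℕ} (hf : IsLevelling H (g u) (g v) m f) :
    IsLevelling G u v m (f ∘ g) where
  first := hf.first
  last := hf.last
  le a := hf.le (g a)
  step a b hab := by
    by_cases hne : g a = g b
    · simp [hne]
    · exact hf.step _ _ ((h.adj_iff _ _).2 ⟨hne, a, b, rfl, rfl, hab⟩)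
  fibers := h.fibers_comp hf.fibers

/-- A chain that leaves `S` does so at `x` and can only return to `x`, so every excursion can be cut
out. -/
theorem IsEdgeCut.chain_of_mem {V : Type} {G : SimpleGraph V} {u v x y : V} {S : Set V}
    (h : IsEdgeCut G u v x y S) {f : V → ℕ} {a b : V} (hab : ReflTransGen (FiberAdj G f) a b)
    (ha : a ∈ S) (hb : b ∈ S) :
    ReflTransGen (fun c d => FiberAdj G f c d ∧ c ∈ S ∧ d ∈ S) a b := by
  -- During an excursion outside `S` the induction remembers a chain inside `S` that ends at `x`,
  -- the point of return.
  have key : (b ∈ S → ReflTransGen (fun c d => FiberAdj G f c d ∧ c ∈ S ∧ d ∈ S) a b) ∧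
      (b ∉ S → ReflTransGen (fun c d => FiberAdj G f c d ∧ c ∈ S ∧ d ∈ S) a x) := by
    clear hb
    induction hab with
    | refl => exact ⟨fun _ => .refl, fun h => absurd ha h⟩
    | @tail c d _ hcd ih =>
      by_cases hc : c ∈ S
      · refine ⟨fun hd => (ih.1 hc).tail ⟨hcd, hc, hd⟩, fun hd => ?_⟩
        rw [← (h.cross c d hcd.1 hc hd).1]
        exact ih.1 hc
      · refine ⟨fun hd => ?_, fun _ => ih.2 hc⟩
        rw [(h.cross d c hcd.1.symm hd hc).1]
        exact ih.2 hc
  exact key.1 hb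

/-- Everything outside `S` moves up by one. Only the common level of `x` and `y` can meet both
sides, and its two halves stay connected by `IsEdgeCut.chain_of_mem`. -/
theorem IsEdgeCut.split {V : Type} {G : SimpleGraph V} {u v x y : V} {S : Set V}
    (h : IsEdgeCut G u v x y S) (hG : G.Connected) {m : ℕ} {f : V → ℕ}
    (hf : IsLevelling G u v m f) (heq : f x = f y) : ∃ f', IsLevelling G u v (m + 1) f' := by
  classical
  have hlow : ∀ a, a ∉ S → f x ≤ f a := fun a ha => by
    by_contra hlt
    exact ha (h.mem_of_lt hG hf a (by omega))
  have hhigh : ∀ a, a ∈ S → f a ≤ f x := fun a ha => by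
    by_contra hlt
    have hy := hf.le y
    have := hf.le a
    -- The complementary cut starts at `y`; by `heq`, a vertex above `x` lies before `y` in the
    -- reversed levelling.
    exact h.compl.mem_of_lt hG hf.reverse a (by omega) ha
  refine ⟨fun a => if a ∈ S then f a else f a + 1, ?_, ?_, fun a => ?_, fun a b hab => ?_,
    fun a b hab => ?_⟩
  · simp [h.left, hf.first]
  · simp [h.right, hf.last]
  · have := hf.le a
    split_ifs <;> omega
  · have := hf.step a b hab
    split_ifs with ha hb hb
    · omega
    · omega
    · obtain ⟨rfl, rfl⟩ := h.cross b a hab.symm hb ha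
      omega
    · omega
  · by_cases ha : a ∈ S <;> by_cases hb : b ∈ S <;> simp only [ha, hb, if_true, if_false] at hab
    · refine chain_mono (h.chain_of_mem (hf.fibers a b hab) ha hb) fun c d hcd => ⟨hcd.1.1, ?_⟩
      simp [hcd.2.1, hcd.2.2, hcd.1.2]
    · have := hlow b hb
      have := hhigh a ha
      omega
    · have := hlow a ha
      have := hhigh b hb
      omega
    · refine chain_mono (h.compl.chain_of_mem (hf.fibers a b (by omega)) ha hb) fun c d hcd =>
        ⟨hcd.1.1, ?_⟩
      have hc : c ∉ S := hcd.2.1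
      have hd : d ∉ S := hcd.2.2
      simp [hc, hd, hcd.1.2]

/-- Contracting a separating edge yields an equivalent instance. -/
theorem PCFEInstance.isYes_iff_of_contractsEdge {I J : PCFEInstance} {g : Fin I.n → Fin J.n}
    {x y : Fin I.n} {S : Set (Fin I.n)} (hc : ContractsEdge I.G J.G g x y)
    (hS : IsEdgeCut I.G I.u I.v x y S) (hu : J.u = g I.u) (hv : J.v = g I.v)
    (hn : I.n = J.n + 1) (hk : J.k = I.k) : I.IsYes ↔ J.IsYes := by
  rw [I.isYes_iff, J.isYes_iff, hu, hv]
  constructor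
  · rintro ⟨m, f, hf, hm⟩
    obtain ⟨m', f', hf', hm'⟩ := hc.exists_isLevelling hf
    exact ⟨m', f', hf', by omega⟩
  · rintro ⟨m, f, hf, hm⟩
    obtain ⟨f', hf'⟩ := hS.split I.connected (hf.comp hc.isQuotient)
      (congrArg f ((hc.eq_iff x y).2 (Or.inr (Or.inl ⟨rfl, rfl⟩))))
    exact ⟨m + 1, f', hf', by omega⟩

/-- A YES instance in which at most the edge `uv` separates `u` from `v` is small. -/
theorem PCFEInstance.IsYes.le_of_reduced {I : PCFEInstance} (hI : I.IsYes)
    (hred : ∀ x y S, I.G.Adj x y → x ∈ S → y ∉ S → IsEdgeCut I.G I.u I.v x y S →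
      x = I.u ∧ y = I.v) : I.n ≤ 3 * I.k + 4 := by
  obtain ⟨m, f, hf, hn⟩ := I.isYes_iff.1 hI
  -- The exempt edge `uv` permits two consecutive singleton levels, but only if they are the whole
  -- graph.
  by_cases h2 : I.n ≤ 2
  · omega
  let c : ℕ → ℕ := fun i => (Finset.univ.filter fun a => f a = i).card
  have hsum : ∑ i ∈ Finset.range (m + 1), c i = I.n := by
    have := Finset.card_eq_sum_card_fiberwise (s := (Finset.univ : Finset (Fin I.n))) (f := f)
      (t := Finset.range (m + 1)) (fun a _ => by
        have := hf.le a
        simp only [Finset.coe_range, Set.mem_Iio]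
        omega)
    simpa using this.symm
  have hpos : ∀ i, i ≤ m → 1 ≤ c i := fun i hi => by
    obtain ⟨a, ha⟩ := hf.exists_eq I.connected hi
    exact Finset.card_pos.2 ⟨a, by simp [ha]⟩
  have hpair : ∀ i, i < m → 3 ≤ c i + c (i + 1) := by
    intro i hi
    have h1 := hpos i hi.le
    have h2' := hpos (i + 1) hi
    by_contra hlt
    obtain ⟨x, y, hxy, hx, hy⟩ := hf.exists_adj I.connected hi
    have hx' : ∀ a, f a = i → a = x := fun a ha =>
      Finset.card_le_one.1 (show c i ≤ 1 by omega) a (by simp [ha]) x (by simp [hx])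
    have hy' : ∀ a, f a = i + 1 → a = y := fun a ha =>
      Finset.card_le_one.1 (show c (i + 1) ≤ 1 by omega) a (by simp [ha]) y (by simp [hy])
    -- Two consecutive singleton levels make `xy` the only edge leaving the levels up to `i`, so it
    -- is the edge `uv`; then `i = 0` and `m = 1`, which forces two vertices in all.
    obtain ⟨rfl, rfl⟩ := hred x y {a | f a ≤ i} hxy hx.le (by simp [hy]) ⟨by simp [hf.first],
      by simp [hf.last, hi], fun a b hab ha hb => by
        have := hf.step b a hab.symm
        simp only [Set.mem_ofPred_eq] at ha hb
        exact ⟨hx' a (by omega), hy' b (by omega)⟩⟩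
    have hi0 : i = 0 := by rw [← hx, hf.first]
    have hm1 : m = 1 := by rw [← hf.last, hy, hi0]
    subst hi0 hm1
    simp only [Finset.sum_range_succ, Finset.sum_range_zero, zero_add] at hsum h1 hlt
    omega
  -- Counting the pairs gives 3m ≤ 2n - c 0 - c m ≤ 2n - 2. With n ≤ m + 1 + k this yields n ≤ 3k +
  -- 1, which is more than is needed.
  have h3 : ∑ i ∈ Finset.range m, 3 ≤ ∑ i ∈ Finset.range m, (c i + c (i + 1)) :=
    Finset.sum_le_sum fun i hi => hpair i (Finset.mem_range.1 hi)
  rw [Finset.sum_add_distrib, Finset.sum_const, Finset.card_range, smul_eq_mul] at h3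
  have h4 := Finset.sum_range_succ c m
  have h5 := Finset.sum_range_succ' c m
  have h6 := hpos 0 (Nat.zero_le _)
  have h7 := hpos m le_rfl
  omega

/-! ### Programs with bounded loops -/

/-- Programs all of whose loops count a register `r` from `0` up to the value of register `0`. -/
inductive Blk where
  | skip
  | setReg (r : ℕ) (e : RamExpr)
  | setArr (a : ℕ) (i j e : RamExpr)
  | seq (p₁ p₂ : Blk)
  | branch (e : RamExpr) (p₁ p₂ : Blk)
  | count (r : ℕ) (p : Blk)

namespace Blk

/-- The registers a program may write. -/
def regs : Blk → List ℕ
  | skip => []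
  | setReg r _ => [r]
  | setArr _ _ _ _ => []
  | seq p₁ p₂ => p₁.regs ++ p₂.regs
  | branch _ p₁ p₂ => p₁.regs ++ p₂.regs
  | count r p => r :: p.regs

/-- The arrays a program may write. -/
def arrs : Blk → List ℕ
  | skip => []
  | setReg _ _ => []
  | setArr a _ _ _ => [a]
  | seq p₁ p₂ => p₁.arrs ++ p₂.arrs
  | branch _ p₁ p₂ => p₁.arrs ++ p₂.arrs
  | count _ p => p.arrs

/-- Register `0` is never written, and no loop body writes the counter of its loop. -/
def Ok : Blk → Bool
  | skip => true
  | setReg r _ => r != 0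
  | setArr _ _ _ _ => true
  | seq p₁ p₂ => p₁.Ok && p₂.Ok
  | branch _ p₁ p₂ => p₁.Ok && p₂.Ok
  | count r p => r != 0 && !p.regs.contains r && p.Ok

/-- The final state. -/
def run : Blk → RamState → RamState
  | skip, s => s
  | setReg r e, s => s.setReg r (e.eval s)
  | setArr a i j e, s => s.setArr a (i.eval s) (j.eval s) (e.eval s)
  | seq p₁ p₂, s => p₂.run (p₁.run s)
  | branch e p₁ p₂, s => if e.eval s ≠ 0 then p₁.run s else p₂.run s
  | count r p, s => (fun s => (p.run s).setReg r ((p.run s).reg r + 1))^[s.reg 0] (s.setReg r 0)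

/-- The loop test is the truncated difference of register `0` and the counter, nonzero exactly while
the counter is smaller. -/
def compile : Blk → RamProg
  | skip => .skip
  | setReg r e => .setReg r e
  | setArr a i j e => .setArr a i j e
  | seq p₁ p₂ => .seq p₁.compile p₂.compile
  | branch e p₁ p₂ => .branch e p₁.compile p₂.compile
  | count r p => .seq (.setReg r (.const 0)) (.loop (.sub (.reg 0) (.reg r))
      (.seq p.compile (.setReg r (.add (.reg r) (.const 1)))))

open Polynomial in
/-- A bound for the running time in terms of the value of register `0`. -/
noncomputable def time : Blk → Polynomial ℕ
  | skip => 1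
  | setReg _ e => C (e.cost + 1)
  | setArr _ i j e => C (i.cost + j.cost + e.cost + 1)
  | seq p₁ p₂ => p₁.time + p₂.time
  | branch e p₁ p₂ => C (e.cost + 1) + p₁.time + p₂.time
  -- Initialising costs 2 and the failing test 4; each round pays 4 for the test and 4 for the
  -- increment.
  | count _ p => 6 + X * (p.time + 8)

end Blk

@[simp] theorem RamState.setReg_reg (s : RamState) (r x q : ℕ) :
    (s.setReg r x).reg q = if q = r then x else s.reg q := rfl

@[simp] theorem RamState.setReg_arr (s : RamState) (r x : ℕ) : (s.setReg r x).arr = s.arr := rfl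

@[simp] theorem RamState.setArr_reg (s : RamState) (a i j x : ℕ) :
    (s.setArr a i j x).reg = s.reg := rfl

@[simp] theorem RamState.setArr_arr (s : RamState) (a i j x a' i' j' : ℕ) :
    (s.setArr a i j x).arr a' i' j' =
      if a' = a ∧ i' = i ∧ j' = j then x else s.arr a' i' j' := rfl

namespace Blk

/-- A frame rule: for a concrete program the hypothesis is settled by `decide`. -/
theorem run_reg {p : Blk} {q : ℕ} (hq : q ∉ p.regs) (s : RamState) :
    (p.run s).reg q = s.reg q := by
  induction p generalizing s with
  | skip => rfl
  | setReg r e => simp_all [regs, run]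
  | setArr a i j e => rfl
  | seq p₁ p₂ ih₁ ih₂ =>
    simp only [regs, List.mem_append, not_or] at hq
    rw [run, ih₂ hq.2, ih₁ hq.1]
  | branch e p₁ p₂ ih₁ ih₂ =>
    simp only [regs, List.mem_append, not_or] at hq
    rw [run]
    split_ifs
    · exact ih₁ hq.1 s
    · exact ih₂ hq.2 s
  | count r p ih =>
    simp only [regs, List.mem_cons, not_or] at hq
    rw [run]
    generalize s.reg 0 = n
    induction n with
    | zero => simp [hq.1]
    | succ n ihn =>
      rw [Function.iterate_succ_apply', RamState.setReg_reg, if_neg hq.1, ih hq.2, ihn]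

theorem run_arr {p : Blk} {a : ℕ} (ha : a ∉ p.arrs) (s : RamState) :
    (p.run s).arr a = s.arr a := by
  induction p generalizing s with
  | skip => rfl
  | setReg r e => rfl
  | setArr b i j e =>
    funext i' j'
    simp_all [arrs, run]
  | seq p₁ p₂ ih₁ ih₂ =>
    simp only [arrs, List.mem_append, not_or] at ha
    rw [run, ih₂ ha.2, ih₁ ha.1]
  | branch e p₁ p₂ ih₁ ih₂ =>
    simp only [arrs, List.mem_append, not_or] at ha
    rw [run]
    split_ifs
    · exact ih₁ ha.1 s
    · exact ih₂ ha.2 s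
  | count r p ih =>
    simp only [arrs] at ha
    rw [run]
    generalize s.reg 0 = n
    induction n with
    | zero => simp
    | succ n ihn => rw [Function.iterate_succ_apply', RamState.setReg_arr, ih ha, ihn]

theorem run_branch_pos {e : RamExpr} {p₁ p₂ : Blk} {s : RamState} (h : e.eval s ≠ 0) :
    (branch e p₁ p₂).run s = p₁.run s :=
  if_pos h

theorem run_branch_neg {e : RamExpr} {p₁ p₂ : Blk} {s : RamState} (h : ¬ e.eval s ≠ 0) :
    (branch e p₁ p₂).run s = p₂.run s :=
  if_neg h

theorem zero_notMem_regs {p : Blk} (hp : p.Ok) : 0 ∉ p.regs := by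
  induction p with
  | skip => simp [regs]
  | setReg r e =>
    simp only [Ok, bne_iff_ne] at hp
    simpa [regs] using hp.symm
  | setArr a i j e => simp [regs]
  | seq p₁ p₂ ih₁ ih₂ => simp_all [regs, Ok]
  | branch e p₁ p₂ ih₁ ih₂ => simp_all [regs, Ok]
  | count r p ih =>
    simp only [Ok, Bool.and_eq_true, bne_iff_ne] at hp
    simpa [regs] using ⟨hp.1.1.symm, ih hp.2⟩

/-- Termination and the time bound come from `Ok`: register `0` never changes, so all parts are
bounded at the same value, and each loop runs that many rounds. -/
theorem exec_run {p : Blk} (hp : p.Ok) (s : RamState) :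
    ∃ t, RamExec p.compile s (p.run s) t ∧ t ≤ p.time.eval (s.reg 0) := by
  induction p generalizing s with
  | skip => exact ⟨_, .skip s, by simp [time]⟩
  | setReg r e => exact ⟨_, .setReg s r e, by simp [time]⟩
  | setArr a i j e => exact ⟨_, .setArr s a i j e, by simp [time]⟩
  | seq p₁ p₂ ih₁ ih₂ =>
    simp only [Ok, Bool.and_eq_true] at hp
    obtain ⟨t₁, h₁, ht₁⟩ := ih₁ hp.1 s
    obtain ⟨t₂, h₂, ht₂⟩ := ih₂ hp.2 (p₁.run s)
    rw [run_reg (zero_notMem_regs hp.1)] at ht₂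
    exact ⟨_, .seq h₁ h₂, by simp only [time, Polynomial.eval_add]; omega⟩
  | branch e p₁ p₂ ih₁ ih₂ =>
    simp only [Ok, Bool.and_eq_true] at hp
    obtain ⟨t₁, h₁, ht₁⟩ := ih₁ hp.1 s
    obtain ⟨t₂, h₂, ht₂⟩ := ih₂ hp.2 s
    rw [run]
    split_ifs with he
    · exact ⟨_, .branch_true he h₁, by simp only [time, Polynomial.eval_add, Polynomial.eval_C]; omega⟩
    · exact ⟨_, .branch_false (not_not.1 he) h₂,
        by simp only [time, Polynomial.eval_add, Polynomial.eval_C]; omega⟩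
  | count r p ih =>
    simp only [Ok, Bool.and_eq_true, bne_iff_ne, Bool.not_eq_true', List.contains_eq_mem,
      decide_eq_false_iff_not] at hp
    obtain ⟨⟨hr, hrp⟩, hp⟩ := hp
    have loop : ∀ (d : ℕ) (s : RamState), s.reg r + d = s.reg 0 → ∃ t,
        RamExec (.loop (.sub (.reg 0) (.reg r))
          (.seq p.compile (.setReg r (.add (.reg r) (.const 1))))) s
          ((fun s => (p.run s).setReg r ((p.run s).reg r + 1))^[d] s) t ∧
        t ≤ 4 + d * (p.time.eval (s.reg 0) + 8) := by
      intro d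
      induction d with
      | zero =>
        intro s hs
        exact ⟨_, .loop_exit (by simp only [RamExpr.eval]; omega), by simp [RamExpr.cost]⟩
      | succ d ihd =>
        intro s hs
        obtain ⟨t₁, h₁, ht₁⟩ := ih hp s
        have h0 : (p.run s).reg 0 = s.reg 0 := run_reg (zero_notMem_regs hp) s
        have hr' : (p.run s).reg r = s.reg r := run_reg hrp s
        obtain ⟨t₂, h₂, ht₂⟩ := ihd ((p.run s).setReg r ((p.run s).reg r + 1)) (by
          simp only [RamState.setReg_reg, if_true, if_neg hr.symm, h0, hr']
          omega)
        refine ⟨_, .loop_step (by simp only [RamExpr.eval]; omega) (.seq h₁ (.setReg _ _ _)) h₂, ?_⟩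
        simp only [RamState.setReg_reg, if_neg hr.symm, h0] at ht₂
        simp only [RamExpr.cost]
        rw [Nat.succ_mul]
        omega
    obtain ⟨t, h, ht⟩ := loop (s.reg 0) (s.setReg r 0) (by simp [hr.symm])
    refine ⟨_, .seq (.setReg s r (.const 0)) h, ?_⟩
    simp only [RamState.setReg_reg, if_neg hr.symm] at ht
    simp only [time, RamExpr.cost, Polynomial.eval_add, Polynomial.eval_mul, Polynomial.eval_X,
      Polynomial.eval_ofNat]
    omega

/-- Loop invariants. -/
theorem run_count_induction {r : ℕ} {p : Blk} {s : RamState} (hp : (count r p).Ok)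
    (Inv : ℕ → RamState → Prop) (h0 : Inv 0 (s.setReg r 0))
    (hstep : ∀ i < s.reg 0, ∀ s' : RamState, s'.reg r = i →
      (∀ q ∉ (count r p).regs, s'.reg q = s.reg q) → (∀ a ∉ p.arrs, s'.arr a = s.arr a) →
      Inv i s' → Inv (i + 1) ((p.run s').setReg r (i + 1))) :
    Inv (s.reg 0) ((count r p).run s) := by
  simp only [Ok, Bool.and_eq_true, bne_iff_ne, Bool.not_eq_true', List.contains_eq_mem,
    decide_eq_false_iff_not] at hp
  have key : ∀ i ≤ s.reg 0, ∀ s',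
      s' = (fun s => (p.run s).setReg r ((p.run s).reg r + 1))^[i] (s.setReg r 0) →
      s'.reg r = i ∧ (∀ q ∉ (count r p).regs, s'.reg q = s.reg q) ∧
      (∀ a ∉ p.arrs, s'.arr a = s.arr a) ∧ Inv i s' := by
    intro i
    induction i with
    | zero =>
      rintro - s' rfl
      refine ⟨by simp, fun q hq => ?_, fun a _ => rfl, h0⟩
      simp only [regs, List.mem_cons, not_or] at hq
      simp [hq.1]
    | succ i ih =>
      intro hi s' hs'
      rw [Function.iterate_succ_apply'] at hs'
      obtain ⟨h1, h2, h3, h4⟩ := ih (by omega) _ rfl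
      have hr := run_reg hp.1.2 ((fun s => (p.run s).setReg r ((p.run s).reg r + 1))^[i]
        (s.setReg r 0))
      rw [hr, h1] at hs'
      subst hs'
      refine ⟨by simp, fun q hq => ?_, fun a ha => ?_, hstep i hi _ h1 h2 h3 h4⟩
      · have hq' := hq
        simp only [regs, List.mem_cons, not_or] at hq'
        rw [RamState.setReg_reg, if_neg hq'.1, run_reg hq'.2, h2 q hq]
      · rw [RamState.setReg_arr, run_arr ha, h3 a ha]
  exact (key _ le_rfl _ rfl).2.2.2

end Blk

/-! ### Loops over pairs of indices. -/

namespace Blk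

/-- Loop invariants for two nested loops in which only the contents of the array `T` matter. -/
theorem run_count_count {T : ℕ} {p : Blk} {s : RamState} (hp : (count 9 (count 10 p)).Ok)
    (K : (ℕ → ℕ → ℕ) → Prop) (P : ℕ → ℕ → (ℕ → ℕ → ℕ) → Prop) (h0 : K (s.arr T))
    (hstep : ∀ i < s.reg 0, ∀ j < s.reg 0, ∀ s' : RamState, s'.reg 9 = i → s'.reg 10 = j →
      (∀ q ∉ (count 9 (count 10 p)).regs, s'.reg q = s.reg q) →
      (∀ a ∉ p.arrs, s'.arr a = s.arr a) → K (s'.arr T) →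
      K ((p.run s').arr T) ∧ P i j ((p.run s').arr T) ∧
        ∀ i' < s.reg 0, ∀ j' < s.reg 0, P i' j' (s'.arr T) → P i' j' ((p.run s').arr T)) :
    K (((count 9 (count 10 p)).run s).arr T) ∧
      ∀ i < s.reg 0, ∀ j < s.reg 0, P i j (((count 9 (count 10 p)).run s).arr T) := by
  have hp' : (count 10 p).Ok := by
    simp only [Ok, Bool.and_eq_true] at hp ⊢
    exact hp.2
  have h9 : 9 ∉ (count 10 p).regs := by
    simp only [Ok, Bool.and_eq_true, bne_iff_ne, Bool.not_eq_true', List.contains_eq_mem,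
      decide_eq_false_iff_not] at hp
    exact hp.1.2
  have h0r := zero_notMem_regs hp
  -- `K` holds throughout; `P i j` is established by the visit to the pair and has to survive all
  -- other visits.
  refine run_count_induction hp (fun i s' => K (s'.arr T) ∧
    ∀ i' < i, ∀ j < s.reg 0, P i' j (s'.arr T)) ⟨h0, fun _ h => absurd h (Nat.not_lt_zero _)⟩ ?_
  intro i hi s₁ hi₁ hr₁ ha₁ hK₁
  have hn : s₁.reg 0 = s.reg 0 := hr₁ 0 h0r
  have inner := run_count_induction (s := s₁) hp' (fun j s' => K (s'.arr T) ∧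
    (∀ i' < i, ∀ j' < s.reg 0, P i' j' (s'.arr T)) ∧ ∀ j' < j, P i j' (s'.arr T))
    ⟨hK₁.1, hK₁.2, fun _ h => absurd h (Nat.not_lt_zero _)⟩ (by
      intro j hj s₂ hj₂ hr₂ ha₂ hK₂
      obtain ⟨k1, k2, k3⟩ := hstep i hi j (hn ▸ hj) s₂ ((hr₂ 9 h9).trans hi₁) hj₂
        (fun q hq => by
          rw [hr₂ q (fun h => hq (List.mem_cons_of_mem _ h)), hr₁ q hq])
        (fun a ha => by rw [ha₂ a ha, ha₁ a ha]) hK₂.1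
      refine ⟨k1, fun i' hi' j' hj' => k3 i' (by omega) j' hj' (hK₂.2.1 i' hi' j' hj'),
        fun j' hj' => ?_⟩
      rcases Nat.lt_succ_iff_lt_or_eq.1 hj' with h | rfl
      · exact k3 i hi j' (by omega) (hK₂.2.2 j' h)
      · exact k2)
  rw [hn] at inner
  refine ⟨inner.1, fun i' hi' j hj => ?_⟩
  rcases Nat.lt_succ_iff_lt_or_eq.1 hi' with h | rfl
  · exact inner.2.1 i' h j hj
  · exact inner.2.2 j hj

/-- Overwrite the array `T` by the values of `e`. -/
def fill (T : ℕ) (e : RamExpr) : Blk := count 9 (count 10 (setArr T (.reg 9) (.reg 10) e))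

/-- The expression is evaluated while `T` is being overwritten, so its value must be determined by
the counters whatever `T` holds. -/
theorem run_fill {T : ℕ} {e : RamExpr} {s : RamState} {F : ℕ → ℕ → ℕ}
    (he : ∀ i < s.reg 0, ∀ j < s.reg 0, ∀ s' : RamState, s'.reg 9 = i → s'.reg 10 = j →
      (∀ a ≠ T, s'.arr a = s.arr a) → e.eval s' = F i j) {i j : ℕ} (hi : i < s.reg 0)
    (hj : j < s.reg 0) : ((fill T e).run s).arr T i j = F i j := by
  refine (run_count_count (T := T) (s := s) (p := setArr T (.reg 9) (.reg 10) e) rfl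
    (fun _ => True) (fun i j X => X i j = F i j) trivial ?_).2 i hi j hj
  intro i hi j hj s' h9 h10 _ ha _
  have := he i hi j hj s' h9 h10 fun a ha' => ha a (by simpa [arrs] using ha')
  refine ⟨trivial, by simp [run, RamExpr.eval, h9, h10, this], fun i' _ j' _ h => ?_⟩
  simp only [run, RamExpr.eval, h9, h10, this, RamState.setArr_arr, true_and]
  split_ifs with hij
  · rw [hij.1, hij.2]
  · exact h

end Blk

/-- An expression that is nonzero exactly if the values of `e₁` and `e₂` differ. -/
def RamExpr.ne (e₁ e₂ : RamExpr) : RamExpr := .add (.sub e₁ e₂) (.sub e₂ e₁)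

theorem RamExpr.eval_ne (e₁ e₂ : RamExpr) (s : RamState) :
    (e₁.ne e₂).eval s ≠ 0 ↔ e₁.eval s ≠ e₂.eval s := by
  simp only [RamExpr.ne, RamExpr.eval]
  omega

theorem RamExpr.eval_add_ne_zero (e₁ e₂ : RamExpr) (s : RamState) :
    (e₁.add e₂).eval s ≠ 0 ↔ e₁.eval s ≠ 0 ∨ e₂.eval s ≠ 0 := by
  simp only [RamExpr.eval]
  omega

/-! ### Reachability -/

/-- The arcs of the digraph on `{0, …, n - 1}` with adjacency matrix `A`, except the arc `xy`. -/
def Arc (n : ℕ) (A : ℕ → ℕ → ℕ) (x y a b : ℕ) : Prop :=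
  a < n ∧ b < n ∧ A a b ≠ 0 ∧ (a ≠ x ∨ b ≠ y)

namespace Blk

/-- If the vertex in register `9` is marked in array `1`, mark the vertex in register `10`, provided
that there is an arc and that it is not the arc between the vertices in the registers `6, 7`. -/
def markStep : Blk :=
  branch (.arr 1 (.reg 9) (.const 0)) (branch (.arr 0 (.reg 9) (.reg 10))
    (branch (.add (.ne (.reg 9) (.reg 6)) (.ne (.reg 10) (.reg 7)))
      (setArr 1 (.reg 10) (.const 0) (.const 1)) skip) skip) skip

def markRound : Blk := count 9 (count 10 markStep)

theorem run_markStep (s : RamState) {n : ℕ} (h9 : s.reg 9 < n) (h10 : s.reg 10 < n) (j : ℕ) :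
    (markStep.run s).arr 1 j 0 ≠ 0 ↔ s.arr 1 j 0 ≠ 0 ∨ (s.arr 1 (s.reg 9) 0 ≠ 0 ∧
      Arc n (s.arr 0) (s.reg 6) (s.reg 7) (s.reg 9) (s.reg 10) ∧ j = s.reg 10) := by
  simp only [Arc, h9, h10, true_and]
  rw [markStep]
  by_cases h1 : s.arr 1 (s.reg 9) 0 ≠ 0
  · rw [run_branch_pos (e := .arr 1 (.reg 9) (.const 0)) h1]
    by_cases h2 : s.arr 0 (s.reg 9) (s.reg 10) ≠ 0
    · rw [run_branch_pos (e := .arr 0 (.reg 9) (.reg 10)) h2]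
      have h3 : (RamExpr.add (.ne (.reg 9) (.reg 6)) (.ne (.reg 10) (.reg 7))).eval s ≠ 0 ↔
          (s.reg 9 ≠ s.reg 6 ∨ s.reg 10 ≠ s.reg 7) := by
        rw [RamExpr.eval_add_ne_zero, RamExpr.eval_ne, RamExpr.eval_ne]
        rfl
      by_cases h4 : s.reg 9 ≠ s.reg 6 ∨ s.reg 10 ≠ s.reg 7
      · rw [run_branch_pos (h3.2 h4)]
        simp only [run, RamExpr.eval, RamState.setArr_arr, and_true, true_and]
        by_cases hj : j = s.reg 10
        · simp [h1, h2, h4, hj]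
        · simp [hj]
      · rw [run_branch_neg (fun h => h4 (h3.1 h))]
        simp [run, h4]
    · rw [run_branch_neg (e := .arr 0 (.reg 9) (.reg 10)) h2]
      simp [run, h2]
  · rw [run_branch_neg (e := .arr 1 (.reg 9) (.const 0)) h1]
    simp [run, h1]

/-- Marks are updated in place, so one round may travel along several arcs. Hence no exact
description: marks persist, they respect every property closed under arcs, and they advance at least
one step. -/
theorem run_markRound (s : RamState) :
    (∀ j, s.arr 1 j 0 ≠ 0 → (markRound.run s).arr 1 j 0 ≠ 0) ∧
    (∀ Q : ℕ → Prop, (∀ a b, Q a → Arc (s.reg 0) (s.arr 0) (s.reg 6) (s.reg 7) a b → Q b) →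
      (∀ j < s.reg 0, s.arr 1 j 0 ≠ 0 → Q j) →
      ∀ j < s.reg 0, (markRound.run s).arr 1 j 0 ≠ 0 → Q j) ∧
    (∀ a b, s.arr 1 a 0 ≠ 0 → Arc (s.reg 0) (s.arr 0) (s.reg 6) (s.reg 7) a b →
      (markRound.run s).arr 1 b 0 ≠ 0) := by
  have main := run_count_count (T := 1) (s := s) (p := markStep) rfl
    (fun X => (∀ j, s.arr 1 j 0 ≠ 0 → X j 0 ≠ 0) ∧
      ∀ Q : ℕ → Prop, (∀ a b, Q a → Arc (s.reg 0) (s.arr 0) (s.reg 6) (s.reg 7) a b → Q b) →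
        (∀ j < s.reg 0, s.arr 1 j 0 ≠ 0 → Q j) → ∀ j < s.reg 0, X j 0 ≠ 0 → Q j)
    (fun a b X => s.arr 1 a 0 ≠ 0 → Arc (s.reg 0) (s.arr 0) (s.reg 6) (s.reg 7) a b → X b 0 ≠ 0)
    ⟨fun _ h => h, fun _ _ h => h⟩ (by
      intro i hi j hj s' h9 h10 hr ha hK
      have step := run_markStep s' (n := s.reg 0) (by omega) (by omega)
      rw [h9, h10, hr 6 (by decide), hr 7 (by decide), ha 0 (by decide)] at step
      refine ⟨⟨fun l hl => (step l).2 (Or.inl (hK.1 l hl)), fun Q hQ hQ0 l hl hl' => ?_⟩, ?_, ?_⟩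
      · rcases (step l).1 hl' with h | ⟨h, harc, rfl⟩
        · exact hK.2 Q hQ hQ0 l hl h
        · exact hQ i _ (hK.2 Q hQ hQ0 i hi h) harc
      · exact fun h harc => (step j).2 (Or.inr ⟨hK.1 i h, harc, rfl⟩)
      · exact fun i' _ j' _ h h1 h2 => (step j').2 (Or.inl (h h1 h2)))
  exact ⟨main.1.1, main.1.2, fun a b h harc => main.2 a harc.1 b harc.2.1 h harc⟩

/-- Mark in array `1` the vertices that can be reached from the vertex in register `1` without using
the arc between the vertices in the registers `6, 7`. -/
def mark : Blk :=
  seq (count 9 (setArr 1 (.reg 9) (.const 0) (.const 0)))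
    (seq (setArr 1 (.reg 1) (.const 0) (.const 1)) (count 8 markRound))

/-- After `i` rounds the marked set is closed under arcs or has at least `i + 1` elements, since a
round that starts from a non-closed set marks something new. After `n` rounds the second case is
impossible. -/
theorem run_mark {s : RamState} {n u x y : ℕ} {A : ℕ → ℕ → ℕ} (hn : s.reg 0 = n)
    (hu : s.reg 1 = u) (hun : u < n) (hx : s.reg 6 = x) (hy : s.reg 7 = y) (hA : s.arr 0 = A)
    {j : ℕ} (hj : j < n) :
    (mark.run s).arr 1 j 0 ≠ 0 ↔ ReflTransGen (Arc n A x y) u j := by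
  classical
  have reach_lt : ∀ {b}, ReflTransGen (Arc n A x y) u b → b < n := by
    intro b hb
    rcases hb.cases_tail with rfl | ⟨c, _, hcb⟩
    · exact hun
    · exact hcb.2.1
  rw [mark, run, run]
  set s₁ := (count 9 (setArr 1 (.reg 9) (.const 0) (.const 0))).run s with hs₁
  have hclear : ∀ j < n, s₁.arr 1 j 0 = 0 := by
    have := run_count_induction (r := 9) (p := setArr 1 (.reg 9) (.const 0) (.const 0)) (s := s) rfl
      (fun i s' => ∀ j < i, s'.arr 1 j 0 = 0) (fun _ h => absurd h (Nat.not_lt_zero _)) (by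
        intro i _ s' hi _ _ h j hj
        simp only [run, RamExpr.eval, RamState.setReg_arr, RamState.setArr_arr, hi, and_true,
          true_and]
        split_ifs with hj'
        · rfl
        · exact h j (by omega))
    rwa [hn] at this
  have reg₁ : ∀ q, q ≠ 9 → s₁.reg q = s.reg q := fun q hq => run_reg (by simpa [regs] using hq) s
  have arr₁ : s₁.arr 0 = A := (run_arr (by decide) s).trans hA
  set s₂ := (setArr 1 (.reg 1) (.const 0) (.const 1)).run s₁ with hs₂
  have reg₂ : ∀ q, q ≠ 9 → s₂.reg q = s.reg q := reg₁
  have arr₂ : s₂.arr 0 = A := (run_arr (by decide) s₁).trans arr₁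
  have hinit : ∀ j < n, s₂.arr 1 j 0 ≠ 0 ↔ j = u := by
    intro j hj
    simp only [hs₂, run, RamExpr.eval, RamState.setArr_arr, reg₁ 1 (by decide), hu, and_true,
      true_and]
    split_ifs with h
    · simp [h]
    · simp [h, hclear j hj]
  have hn₂ : s₂.reg 0 = n := (reg₂ 0 (by decide)).trans hn
  let S : RamState → Finset ℕ := fun s' => (Finset.range n).filter fun j => s'.arr 1 j 0 ≠ 0
  have hS : ∀ s' b, b ∈ S s' ↔ b < n ∧ s'.arr 1 b 0 ≠ 0 := fun s' b => by simp [S]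
  have main := run_count_induction (r := 8) (p := markRound) (s := s₂) rfl
    (fun i s' => u ∈ S s' ∧ (∀ j ∈ S s', ReflTransGen (Arc n A x y) u j) ∧
      ((∀ a b, a ∈ S s' → Arc n A x y a b → b ∈ S s') ∨ i + 1 ≤ (S s').card))
    (by
      have h0 : ∀ b, b ∈ S (s₂.setReg 8 0) ↔ b = u := fun b => by
        rw [hS, RamState.setReg_arr]
        exact ⟨fun h => (hinit b h.1).1 h.2, fun h => ⟨h ▸ hun, (hinit b (h ▸ hun)).2 h⟩⟩
      refine ⟨(h0 u).2 rfl, fun j hj => (h0 j).1 hj ▸ .refl, Or.inr ?_⟩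
      exact Finset.card_pos.2 ⟨u, (h0 u).2 rfl⟩)
    (by
      intro i hi s' _ hr ha hinv
      obtain ⟨r1, r2, r3⟩ := run_markRound s'
      rw [hr 0 (by decide), hr 6 (by decide), hr 7 (by decide), ha 0 (by decide), hn₂,
        reg₂ 6 (by decide), reg₂ 7 (by decide), hx, hy, arr₂] at r2 r3
      set s'' := (markRound.run s').setReg 8 (i + 1) with hs''
      have hS'' : ∀ b, b ∈ S s'' ↔ b < n ∧ (markRound.run s').arr 1 b 0 ≠ 0 := fun b => by
        rw [hS, hs'', RamState.setReg_arr]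
      have hsub : S s' ⊆ S s'' := fun b hb =>
        (hS'' b).2 ⟨((hS s' b).1 hb).1, r1 b ((hS s' b).1 hb).2⟩
      have hnext : ∀ a b, a ∈ S s' → Arc n A x y a b → b ∈ S s'' := fun a b hb harc =>
        (hS'' b).2 ⟨harc.2.1, r3 a b ((hS s' a).1 hb).2 harc⟩
      refine ⟨hsub hinv.1, fun b hb => ?_, ?_⟩
      · exact r2 (ReflTransGen (Arc n A x y) u) (fun a b h harc => h.tail harc)
          (fun c hc hc' => hinv.2.1 c ((hS s' c).2 ⟨hc, hc'⟩)) b ((hS'' b).1 hb).1 ((hS'' b).1 hb).2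
      · by_cases hcl : ∀ a b, a ∈ S s' → Arc n A x y a b → b ∈ S s'
        · left
          have hsub' : S s'' ⊆ S s' := fun b hb =>
            r2 (· ∈ S s') hcl (fun c hc hc' => (hS s' c).2 ⟨hc, hc'⟩) b ((hS'' b).1 hb).1
              ((hS'' b).1 hb).2
          exact fun a b hab harc => hsub (hcl a b (hsub' hab) harc)
        · right
          have hcard := hinv.2.2.resolve_left hcl
          push Not at hcl
          obtain ⟨a, b, ha', harc, hb⟩ := hcl
          have : (S s').card < (S s'').card := Finset.card_lt_card
            ⟨hsub, fun h => hb (h (hnext a b ha' harc))⟩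
          omega)
  rw [hn₂] at main
  obtain ⟨m1, m2, m3⟩ := main
  have hclosed := m3.resolve_right fun h => by
    have := Finset.card_filter_le (Finset.range n)
      fun j => ((count 8 markRound).run s₂).arr 1 j 0 ≠ 0
    rw [Finset.card_range] at this
    exact absurd (h.trans this) (by omega)
  refine ⟨fun h => m2 j ((hS _ j).2 ⟨hj, h⟩), fun h => ?_⟩
  have : j ∈ S ((count 8 markRound).run s₂) := by
    clear hj
    induction h with
    | refl => exact m1
    | tail _ hcd ih => exact hclosed _ _ ih hcd
  exact ((hS _ j).1 this).2

end Blk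

/-! ### Searching for a separating edge -/

/-- The arc `xy` lies on all paths from `u` to `v`, and it is not the arc `uv`. -/
def IsCutArc (n : ℕ) (A : ℕ → ℕ → ℕ) (u v x y : ℕ) : Prop :=
  A x y ≠ 0 ∧ (x ≠ u ∨ y ≠ v) ∧ ¬ ReflTransGen (Arc n A x y) u v

namespace Blk

def searchStep : Blk :=
  branch (.arr 0 (.reg 6) (.reg 7))
    (branch (.add (.ne (.reg 6) (.reg 1)) (.ne (.reg 7) (.reg 2)))
      (seq mark (branch (.arr 1 (.reg 2) (.const 0)) skip
        (seq (setReg 11 (.const 1)) (seq (setReg 12 (.reg 6)) (setReg 13 (.reg 7)))))) skip) skip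

/-- Look for a cut arc; on success set register `11` and put the arc into the registers `12, 13`. -/
def search : Blk := seq (setReg 11 (.const 0)) (count 6 (count 7 searchStep))

theorem run_searchStep {s : RamState} {n u v x y : ℕ} {A : ℕ → ℕ → ℕ} (hn : s.reg 0 = n)
    (hu : s.reg 1 = u) (hv : s.reg 2 = v) (hun : u < n) (hvn : v < n) (hx : s.reg 6 = x)
    (hy : s.reg 7 = y) (hA : s.arr 0 = A) :
    (IsCutArc n A u v x y ∧ (searchStep.run s).reg 11 = 1 ∧ (searchStep.run s).reg 12 = x ∧
      (searchStep.run s).reg 13 = y) ∨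
    (¬ IsCutArc n A u v x y ∧ (searchStep.run s).reg 11 = s.reg 11 ∧
      (searchStep.run s).reg 12 = s.reg 12 ∧ (searchStep.run s).reg 13 = s.reg 13) := by
  have hm := run_mark hn hu hun hx hy hA hvn
  have hreg : ∀ q, q ∉ mark.regs → (mark.run s).reg q = s.reg q := fun q hq => run_reg hq s
  have h2 : (RamExpr.add (.ne (.reg 6) (.reg 1)) (.ne (.reg 7) (.reg 2))).eval s ≠ 0 ↔
      (x ≠ u ∨ y ≠ v) := by
    rw [RamExpr.eval_add_ne_zero, RamExpr.eval_ne, RamExpr.eval_ne, ← hx, ← hy, ← hu, ← hv]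
    rfl
  have h1 : (RamExpr.arr 0 (.reg 6) (.reg 7)).eval s ≠ 0 ↔ A x y ≠ 0 := by
    rw [← hx, ← hy, ← hA]
    rfl
  have h3 : (RamExpr.arr 1 (.reg 2) (.const 0)).eval (mark.run s) ≠ 0 ↔
      ReflTransGen (Arc n A x y) u v := by
    rw [← hm, ← hv, ← hreg 2 (by decide)]
    rfl
  rw [searchStep, IsCutArc]
  by_cases c1 : A x y ≠ 0
  · rw [run_branch_pos (h1.2 c1)]
    by_cases c2 : x ≠ u ∨ y ≠ v
    · rw [run_branch_pos (h2.2 c2), run]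
      by_cases c3 : ReflTransGen (Arc n A x y) u v
      · rw [run_branch_pos (h3.2 c3)]
        exact Or.inr ⟨fun h => h.2.2 c3, hreg 11 (by decide), hreg 12 (by decide),
          hreg 13 (by decide)⟩
      · rw [run_branch_neg fun h => c3 (h3.1 h)]
        refine Or.inl ⟨⟨c1, c2, c3⟩, ?_⟩
        simp [run, RamExpr.eval, hreg 6 (by decide), hreg 7 (by decide), hx, hy]
    · rw [run_branch_neg fun h => c2 (h2.1 h)]
      exact Or.inr ⟨fun h => c2 h.2.1, rfl, rfl, rfl⟩
  · rw [run_branch_neg fun h => c1 (h1.1 h)]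
    exact Or.inr ⟨fun h => c1 h.1, rfl, rfl, rfl⟩

/-- The flag is never reset and later hits overwrite earlier ones, so the invariant only claims that
the stored arc is some cut arc. -/
theorem run_search {s : RamState} {n u v : ℕ} {A : ℕ → ℕ → ℕ} (hn : s.reg 0 = n)
    (hu : s.reg 1 = u) (hv : s.reg 2 = v) (hun : u < n) (hvn : v < n) (hA : s.arr 0 = A) :
    ((search.run s).reg 11 = 0 ∧ ∀ x < n, ∀ y < n, ¬ IsCutArc n A u v x y) ∨
    ((search.run s).reg 11 ≠ 0 ∧ (search.run s).reg 12 < n ∧ (search.run s).reg 13 < n ∧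
      IsCutArc n A u v ((search.run s).reg 12) ((search.run s).reg 13)) := by
  rw [search, run, run]
  simp only [RamExpr.eval]
  have main := run_count_induction (r := 6) (p := count 7 searchStep) (s := s.setReg 11 0) rfl
    (fun i s' => (s'.reg 11 = 0 ∧ ∀ x < i, ∀ y < n, ¬ IsCutArc n A u v x y) ∨
      (s'.reg 11 ≠ 0 ∧ s'.reg 12 < n ∧ s'.reg 13 < n ∧
        IsCutArc n A u v (s'.reg 12) (s'.reg 13)))
    (Or.inl ⟨by simp, fun _ h => absurd h (Nat.not_lt_zero _)⟩) (by
      intro i hi s₁ hi₁ hr₁ ha₁ hinv₁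
      have hn₁ : s₁.reg 0 = n := (hr₁ 0 (by decide)).trans (by simpa using hn)
      have hin : i < n := by simpa [hn] using hi
      have inner := run_count_induction (r := 7) (p := searchStep) (s := s₁) rfl
        (fun j s' => (s'.reg 11 = 0 ∧ (∀ x < i, ∀ y < n, ¬ IsCutArc n A u v x y) ∧
          ∀ y < j, ¬ IsCutArc n A u v i y) ∨
          (s'.reg 11 ≠ 0 ∧ s'.reg 12 < n ∧ s'.reg 13 < n ∧
            IsCutArc n A u v (s'.reg 12) (s'.reg 13)))
        (hinv₁.imp (fun h => ⟨by simpa using h.1, h.2, fun _ h => absurd h (Nat.not_lt_zero _)⟩)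
          (fun h => by simpa using h)) (by
          intro j hj s₂ hj₂ hr₂ ha₂ hinv₂
          rw [hn₁] at hj
          have step := run_searchStep (s := s₂) (x := i) (y := j)
            ((hr₂ 0 (by decide)).trans hn₁)
            (((hr₂ 1 (by decide)).trans (hr₁ 1 (by decide))).trans (by simpa using hu))
            (((hr₂ 2 (by decide)).trans (hr₁ 2 (by decide))).trans (by simpa using hv))
            hun hvn ((hr₂ 6 (by decide)).trans hi₁) hj₂
            (((ha₂ 0 (by decide)).trans (ha₁ 0 (by decide))).trans hA)
          simp only [RamState.setReg_reg, show ¬ (11 = 7) by decide, show ¬ (12 = 7) by decide,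
            show ¬ (13 = 7) by decide, if_false]
          rcases step with ⟨hc, h11, h12, h13⟩ | ⟨hc, h11, h12, h13⟩
          · rw [h11, h12, h13]
            exact Or.inr ⟨one_ne_zero, hin, hj, hc⟩
          · rw [h11, h12, h13]
            refine hinv₂.imp_left fun h => ⟨h.1, h.2.1, fun y hy => ?_⟩
            rcases Nat.lt_succ_iff_lt_or_eq.1 hy with h' | rfl
            · exact h.2.2 y h'
            · exact hc)
      rw [hn₁] at inner
      simp only [RamState.setReg_reg, show ¬ (11 = 6) by decide, show ¬ (12 = 6) by decide,
        show ¬ (13 = 6) by decide, if_false]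
      refine inner.imp_left fun h => ⟨h.1, fun x hx => ?_⟩
      rcases Nat.lt_succ_iff_lt_or_eq.1 hx with h' | rfl
      · exact h.2.1 x h'
      · exact h.2.2)
  have h0 : (s.setReg 11 0).reg 0 = n := by simpa using hn
  rwa [h0] at main

end Blk

/-! ### Contracting an edge -/

/-- The new name of the vertex `a` after contracting the edge `xy`: the vertex `y` is identified
with `x`, and the names greater than `y` decrease by one. -/
def contractName (x y a : ℕ) : ℕ :=
  if y < (if a = y then x else a) then (if a = y then x else a) - 1 else if a = y then x else a

theorem contractName_eq_iff {x y : ℕ} (hxy : x ≠ y) (a b : ℕ) :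
    contractName x y a = contractName x y b ↔ a = b ∨ (a = x ∧ b = y) ∨ (a = y ∧ b = x) := by
  unfold contractName
  split_ifs <;> omega

theorem contractName_lt {x y n a : ℕ} (hxy : x ≠ y) (hx : x < n) (hy : y < n) (ha : a < n) :
    contractName x y a < n - 1 := by
  unfold contractName
  split_ifs <;> omega

theorem contractName_surj {x y n c : ℕ} (hc : c < n - 1) :
    ∃ a < n, contractName x y a = c := by
  unfold contractName
  by_cases h : c < y
  · refine ⟨c, by omega, ?_⟩
    rw [if_neg (show ¬ c = y by omega), if_neg (by omega)]
  · refine ⟨c + 1, by omega, ?_⟩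
    rw [if_neg (show ¬ c + 1 = y by omega), if_pos (by omega)]
    rfl

namespace Blk

/-- With truncated subtraction, `1 - (1 - d)` is the indicator of `0 < d`; thus one is subtracted
exactly from the names above the removed one. -/
def nameStep : Blk :=
  seq (branch (.ne (.reg 9) (.reg 13)) (setReg 14 (.reg 9)) (setReg 14 (.reg 12)))
    (setArr 2 (.reg 9) (.const 0)
      (.sub (.reg 14) (.sub (.const 1) (.sub (.const 1) (.sub (.reg 14) (.reg 13))))))

/-- Put the new names of the vertices into array `2`. -/
def names : Blk := count 9 nameStep

theorem run_nameStep (s : RamState) : (nameStep.run s).arr =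
    (s.setArr 2 (s.reg 9) 0 (contractName (s.reg 12) (s.reg 13) (s.reg 9))).arr := by
  have key : ∀ h y : ℕ, h - (1 - (1 - (h - y))) = if y < h then h - 1 else h := fun h y => by
    split_ifs <;> omega
  rw [nameStep, run, contractName, ← key]
  by_cases h : s.reg 9 = s.reg 13
  · rw [run_branch_neg fun h' => (RamExpr.eval_ne (.reg 9) (.reg 13) s).1 h' h, if_pos h]
    simp [run, RamExpr.eval, RamState.setArr]
  · rw [run_branch_pos ((RamExpr.eval_ne (.reg 9) (.reg 13) s).2 h), if_neg h]
    simp [run, RamExpr.eval, RamState.setArr]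

theorem run_names {s : RamState} {a : ℕ} (ha : a < s.reg 0) :
    (names.run s).arr 2 a 0 = contractName (s.reg 12) (s.reg 13) a := by
  refine run_count_induction (r := 9) (p := nameStep) (s := s) rfl
    (fun i s' => ∀ a < i, s'.arr 2 a 0 = contractName (s.reg 12) (s.reg 13) a)
    (fun _ h => absurd h (Nat.not_lt_zero _)) ?_ a ha
  intro i _ s' h9 hr _ hinv a ha
  rw [RamState.setReg_arr, run_nameStep, h9, hr 12 (by decide), hr 13 (by decide)]
  simp only [RamState.setArr_arr, and_true, true_and]
  split_ifs with h
  · rw [h]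
  · exact hinv a (by omega)

def joinStep : Blk :=
  branch (.arr 0 (.reg 9) (.reg 10))
    (branch (.ne (.arr 2 (.reg 9) (.const 0)) (.arr 2 (.reg 10) (.const 0)))
      (setArr 3 (.arr 2 (.reg 9) (.const 0)) (.arr 2 (.reg 10) (.const 0)) (.const 1)) skip) skip

/-- Put the adjacency matrix of the quotient under the names in array `2` into array `3`, which is
assumed to be zero. -/
def join : Blk := count 9 (count 10 joinStep)

/-- The quotient of the graph with adjacency matrix `A` by the map `g` has the edge `ij`. -/
def QuotientEdge (n : ℕ) (A : ℕ → ℕ → ℕ) (g : ℕ → ℕ) (i j : ℕ) : Prop :=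
  i ≠ j ∧ ∃ a < n, ∃ b < n, A a b ≠ 0 ∧ g a = i ∧ g b = j

open Classical in
theorem run_join {s : RamState} {n : ℕ} {A : ℕ → ℕ → ℕ} {g : ℕ → ℕ} (hn : s.reg 0 = n)
    (hA : s.arr 0 = A) (hg : ∀ a < n, s.arr 2 a 0 = g a)
    (h3 : ∀ i < n, ∀ j < n, s.arr 3 i j = 0) {i j : ℕ} (hi : i < n) (hj : j < n) :
    (join.run s).arr 3 i j = if QuotientEdge n A g i j then 1 else 0 := by
  have main := run_count_count (T := 3) (s := s) (p := joinStep) rfl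
    (fun X => ∀ i < n, ∀ j < n, X i j ≠ 0 → X i j = 1 ∧ QuotientEdge n A g i j)
    (fun a b X => A a b ≠ 0 → g a ≠ g b → X (g a) (g b) ≠ 0)
    (fun i hi j hj h => absurd (h3 i hi j hj) h) (by
      intro a ha b hb s' h9 h10 _ hX hK
      rw [hn] at ha hb
      have e1 : (RamExpr.arr 0 (.reg 9) (.reg 10)).eval s' = A a b := by
        rw [← h9, ← h10, ← hA, ← hX 0 (by decide)]
        rfl
      have e2 : (RamExpr.arr 2 (.reg 9) (.const 0)).eval s' = g a := by
        rw [← hg a ha, ← h9, ← hX 2 (by decide)]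
        rfl
      have e3 : (RamExpr.arr 2 (.reg 10) (.const 0)).eval s' = g b := by
        rw [← hg b hb, ← h10, ← hX 2 (by decide)]
        rfl
      rw [joinStep]
      by_cases c1 : A a b ≠ 0
      · rw [run_branch_pos (by rwa [e1])]
        by_cases c2 : g a ≠ g b
        · rw [run_branch_pos (by rwa [RamExpr.eval_ne, e2, e3]), run, e2, e3]
          simp only [RamExpr.eval, RamState.setArr_arr, true_and]
          refine ⟨fun i hi j hj hij => ?_, fun _ _ => by simp, fun i' _ j' _ h c c' => ?_⟩
          · split_ifs at hij ⊢ with h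
            · exact ⟨rfl, by rw [h.1, h.2]; exact c2, a, ha, b, hb, c1, h.1.symm, h.2.symm⟩
            · exact hK i hi j hj hij
          · split_ifs
            · exact one_ne_zero
            · exact h c c'
        · rw [run_branch_neg (by rwa [RamExpr.eval_ne, e2, e3])]
          exact ⟨hK, fun _ h => absurd h c2, fun _ _ _ _ h => h⟩
      · rw [run_branch_neg (by rwa [e1])]
        exact ⟨hK, fun h => absurd h c1, fun _ _ _ _ h => h⟩)
  rw [hn] at main
  split_ifs with h
  · obtain ⟨hne, a, ha, b, hb, hab, rfl, rfl⟩ := h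
    exact (main.1 _ hi _ hj (main.2 a ha b hb hab hne)).1
  · by_contra h'
    exact h (main.1 i hi j hj h').2

/-- Contract the edge between the vertices in the registers `12, 13`. Register `4` holds the number
of vertices. -/
def contract : Blk :=
  -- Array `3` may still hold the matrix of an earlier contraction, so it is cleared before use.
  seq names (seq (fill 3 (.const 0)) (seq join (seq (fill 0 (.arr 3 (.reg 9) (.reg 10)))
    (seq (setReg 1 (.arr 2 (.reg 1) (.const 0))) (seq (setReg 2 (.arr 2 (.reg 2) (.const 0)))
      (setReg 4 (.sub (.reg 4) (.const 1))))))))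

open Classical in
theorem run_contract {s : RamState} {n u v x y : ℕ} {A : ℕ → ℕ → ℕ} (hn : s.reg 0 = n)
    (hu : s.reg 1 = u) (hv : s.reg 2 = v) (hun : u < n) (hvn : v < n) (hx : s.reg 12 = x)
    (hy : s.reg 13 = y) (hA : s.arr 0 = A) :
    (contract.run s).reg 1 = contractName x y u ∧ (contract.run s).reg 2 = contractName x y v ∧
    (contract.run s).reg 4 = s.reg 4 - 1 ∧
    ∀ i < n, ∀ j < n, (contract.run s).arr 0 i j =
      if QuotientEdge n A (contractName x y) i j then 1 else 0 := by
  rw [contract, run, run, run, run]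
  set s₁ := names.run s with hs₁
  set s₂ := (fill 3 (.const 0)).run s₁ with hs₂
  set s₃ := join.run s₂ with hs₃
  set s₄ := (fill 0 (.arr 3 (.reg 9) (.reg 10))).run s₃ with hs₄
  have n₁ : s₁.reg 0 = n := (run_reg (by decide) s).trans hn
  have n₂ : s₂.reg 0 = n := (run_reg (by decide) s₁).trans n₁
  have n₃ : s₃.reg 0 = n := (run_reg (by decide) s₂).trans n₂
  have names₁ : ∀ a < n, s₁.arr 2 a 0 = contractName x y a := fun a ha => by
    rw [hs₁, run_names (hn ▸ ha), hx, hy]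
  have arr₂ : s₂.arr 2 = s₁.arr 2 := run_arr (by decide) s₁
  have arr₄ : s₄.arr 2 = s₁.arr 2 :=
    (run_arr (by decide) s₃).trans ((run_arr (by decide) s₂).trans arr₂)
  have regs₄ : ∀ q, q ∉ (seq names (seq (fill 3 (.const 0)) (seq join
      (fill 0 (.arr 3 (.reg 9) (.reg 10)))))).regs → s₄.reg q = s.reg q := fun q hq => run_reg hq s
  have h3 : ∀ i < n, ∀ j < n, s₂.arr 3 i j = 0 := fun i hi j hj =>
    run_fill (F := fun _ _ => 0) (fun _ _ _ _ _ _ _ _ => rfl) (n₁ ▸ hi) (n₁ ▸ hj)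
  have hjoin : ∀ i < n, ∀ j < n, s₃.arr 3 i j =
      if QuotientEdge n A (contractName x y) i j then 1 else 0 := fun i hi j hj =>
    run_join n₂ (((run_arr (by decide) s₁).trans (run_arr (by decide) s)).trans hA)
      (fun a ha => by rw [arr₂, names₁ a ha]) h3 hi hj
  simp only [run, RamState.setReg_reg, RamState.setReg_arr, RamExpr.eval, arr₄,
    regs₄ 1 (by decide), regs₄ 2 (by decide), regs₄ 4 (by decide), hu, hv]
  refine ⟨by simp [names₁ u hun], by simp [names₁ v hvn], by simp, fun i hi j hj => ?_⟩
  refine (run_fill (F := s₃.arr 3) (fun i _ j _ s' h9 h10 ha => ?_) (n₃ ▸ hi) (n₃ ▸ hj)).trans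
    (hjoin i hi j hj)
  rw [← ha 3 (by decide), ← h9, ← h10]
  rfl

end Blk

/-! ### Instances in memory -/

/-- The state `s` holds the instance `J`, padded by isolated vertices to `n` vertices. -/
structure PCFEInstance.IsHeld (J : PCFEInstance) (n : ℕ) (s : RamState) : Prop where
  size : s.reg 0 = n
  le : J.n ≤ n
  left : s.reg 1 = J.u
  right : s.reg 2 = J.v
  param : s.reg 3 = J.k
  card : s.reg 4 = J.n
  entry : ∀ i < n, ∀ j < n, s.arr 0 i j = J.entry i j

/-- At most the edge `uv` separates `u` from `v`. -/
def PCFEInstance.Reduced (J : PCFEInstance) : Prop :=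
  ∀ x y S, J.G.Adj x y → x ∈ S → y ∉ S → IsEdgeCut J.G J.u J.v x y S → x = J.u ∧ y = J.v

theorem PCFEInstance.entry_ne_zero_iff {J : PCFEInstance} {i j : ℕ} :
    J.entry i j ≠ 0 ↔ ∃ a b : Fin J.n, a.val = i ∧ b.val = j ∧ J.G.Adj a b := by
  unfold PCFEInstance.entry
  split_ifs with h
  · simpa using h
  · simpa using h

theorem PCFEInstance.IsHeld.entry_ne_zero {J : PCFEInstance} {n : ℕ} {s : RamState}
    (h : J.IsHeld n s) {i j : ℕ} (hi : i < n) (hj : j < n) :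
    s.arr 0 i j ≠ 0 ↔ ∃ a b : Fin J.n, a.val = i ∧ b.val = j ∧ J.G.Adj a b := by
  rw [h.entry i hi j hj, J.entry_ne_zero_iff]

/-- `S` consists of the vertices still reachable from `u` without the arc; an edge leaving it other
than `xy` would extend it. Some edge does leave it, which places `x` inside and `y` outside. -/
theorem IsCutArc.exists_isEdgeCut {J : PCFEInstance} {n : ℕ} {s : RamState} (h : J.IsHeld n s)
    {x y : ℕ} (hx : x < n) (hy : y < n) (hc : IsCutArc n (s.arr 0) J.u J.v x y) :
    ∃ (x' y' : Fin J.n) (S : Set (Fin J.n)), x'.val = x ∧ y'.val = y ∧ J.G.Adj x' y' ∧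
      x' ∈ S ∧ y' ∉ S ∧ IsEdgeCut J.G J.u J.v x' y' S ∧ ¬ (x' = J.u ∧ y' = J.v) := by
  obtain ⟨hA, hne, hr⟩ := hc
  obtain ⟨x', y', rfl, rfl, hxy⟩ := (h.entry_ne_zero hx hy).1 hA
  have hlt : ∀ a : Fin J.n, a.val < n := fun a => a.2.trans_le h.le
  set S : Set (Fin J.n) := {a | ReflTransGen (Arc n (s.arr 0) x' y') J.u a} with hS
  have hcut : IsEdgeCut J.G J.u J.v x' y' S := by
    refine ⟨.refl, hr, fun a b hab ha hb => ?_⟩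
    by_contra hne'
    refine hb (ReflTransGen.tail ha ⟨hlt a, hlt b,
      (h.entry_ne_zero (hlt a) (hlt b)).2 ⟨a, b, rfl, rfl, hab⟩, ?_⟩)
    rw [Fin.ext_iff, Fin.ext_iff] at hne'
    omega
  obtain ⟨c, d, hcd, hcS, hdS⟩ := exists_crossing (P := (· ∈ S)) (J.connected.reflTransGen J.u J.v)
    hcut.left hcut.right
  obtain ⟨rfl, rfl⟩ := hcut.cross c d hcd hcS hdS
  refine ⟨c, d, S, rfl, rfl, hxy, hcS, hdS, hcut, fun h' => ?_⟩
  rw [Fin.ext_iff, Fin.ext_iff] at h'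
  omega

/-- A walk from `u` to `v` must leave `S`, hence use the arc from `x` to `y`. The reverse arc only
leads into `S`, so deleting one direction is enough. -/
theorem PCFEInstance.IsHeld.reduced {J : PCFEInstance} {n : ℕ} {s : RamState} (h : J.IsHeld n s)
    (hno : ∀ x < n, ∀ y < n, ¬ IsCutArc n (s.arr 0) J.u J.v x y) : J.Reduced := by
  intro x y S hxy hxS hyS hcut
  have hlt : ∀ a : Fin J.n, a.val < n := fun a => a.2.trans_le h.le
  by_contra hne
  refine hno x (hlt x) y (hlt y)
    ⟨(h.entry_ne_zero (hlt x) (hlt y)).2 ⟨x, y, rfl, rfl, hxy⟩, ?_, fun hr => ?_⟩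
  · rw [Fin.ext_iff, Fin.ext_iff] at hne
    omega
  · obtain ⟨c, d, ⟨hc, hd, hcd, hcd'⟩, ⟨c', hc', hcS⟩, hdS⟩ := exists_crossing
      (P := fun z => ∃ z' : Fin J.n, z'.val = z ∧ z' ∈ S) hr ⟨J.u, rfl, hcut.left⟩ (by
        rintro ⟨z', hz, hzS⟩
        rw [Fin.ext hz] at hzS
        exact hcut.right hzS)
    obtain ⟨a, b, ha, rfl, hab⟩ := (h.entry_ne_zero hc hd).1 hcd
    obtain rfl : a = c' := Fin.ext (ha.trans hc'.symm)
    obtain ⟨rfl, rfl⟩ := hcut.cross a b hab hcS fun hb => hdS ⟨b, rfl, hb⟩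
    omega

/-- The effect of contracting a separating edge in memory. -/
theorem PCFEInstance.IsHeld.contract {J : PCFEInstance} {n : ℕ} {s : RamState} (h : J.IsHeld n s)
    {x y : Fin J.n} {S : Set (Fin J.n)} (hx : s.reg 12 = x) (hy : s.reg 13 = y)
    (hxy : J.G.Adj x y) (hS : IsEdgeCut J.G J.u J.v x y S) (hyS : y ∉ S)
    (hne : ¬ (x = J.u ∧ y = J.v)) :
    ∃ J' : PCFEInstance, J'.IsHeld n (Blk.contract.run s) ∧ (J.IsYes ↔ J'.IsYes) ∧ J'.k = J.k ∧
      (J.u ≠ J.v → J'.u ≠ J'.v) ∧ J.n = J'.n + 1 := by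
  classical
  have hlt : ∀ a : Fin J.n, a.val < n := fun a => a.2.trans_le h.le
  have hxy' : x.val ≠ y.val := fun h => hxy.ne (Fin.ext h)
  let g : Fin J.n → Fin (J.n - 1) := fun a =>
    ⟨contractName x y a, contractName_lt hxy' x.2 y.2 a.2⟩
  let H : SimpleGraph (Fin (J.n - 1)) :=
    { Adj := fun p q => p ≠ q ∧ ∃ a b, g a = p ∧ g b = q ∧ J.G.Adj a b
      symm := ⟨fun p q ⟨hpq, a, b, ha, hb, hab⟩ => ⟨hpq.symm, b, a, hb, ha, hab.symm⟩⟩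
      loopless := ⟨fun p hp => hp.1 rfl⟩ }
  have hg : ∀ a b, g a = g b ↔ a = b ∨ (a = x ∧ b = y) ∨ (a = y ∧ b = x) := fun a b => by
    simp only [g, Fin.ext_iff, contractName_eq_iff hxy']
  have hc : ContractsEdge J.G H g x y := by
    refine ⟨hxy, fun c => ?_, hg, fun _ _ => Iff.rfl⟩
    obtain ⟨a, ha, hac⟩ := contractName_surj (x := x) (y := y) c.2
    exact ⟨⟨a, ha⟩, Fin.ext hac⟩
  let J' : PCFEInstance := ⟨J.n - 1, H, hc.isQuotient.connected J.connected, g J.u, g J.v, J.k⟩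
  have hpos : 0 < J.n := x.pos
  obtain ⟨r1, r2, r4, r0⟩ := Blk.run_contract h.size h.left h.right (hlt _) (hlt _) hx hy rfl
  refine ⟨J', ⟨(Blk.run_reg (by decide) s).trans h.size, (Nat.sub_le _ _).trans h.le, r1, r2,
    (Blk.run_reg (by decide) s).trans h.param, by rw [r4, h.card], fun i hi j hj => ?_⟩,
    PCFEInstance.isYes_iff_of_contractsEdge (J := J') hc hS rfl rfl (by simp only [J']; omega) rfl,
    rfl, fun huv heq => ?_, by simp only [J']; omega⟩
  · have hiff : Blk.QuotientEdge n (s.arr 0) (contractName x y) i j ↔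
        ∃ p q : Fin (J.n - 1), p.val = i ∧ q.val = j ∧ H.Adj p q := by
      constructor
      · rintro ⟨hij, a, ha, b, hb, hab, rfl, rfl⟩
        obtain ⟨a, b, rfl, rfl, hab'⟩ := (h.entry_ne_zero ha hb).1 hab
        exact ⟨g a, g b, rfl, rfl, fun h => hij (congrArg Fin.val h), a, b, rfl, rfl, hab'⟩
      · rintro ⟨p, q, rfl, rfl, hpq, a, b, rfl, rfl, hab⟩
        exact ⟨fun h => hpq (Fin.ext h), a, hlt a, b, hlt b,
          (h.entry_ne_zero (hlt a) (hlt b)).2 ⟨a, b, rfl, rfl, hab⟩, rfl, rfl⟩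
    rw [r0 i hi j hj]
    by_cases hq : Blk.QuotientEdge n (s.arr 0) (contractName x y) i j
    · exact (if_pos hq).trans (if_pos (hiff.1 hq)).symm
    · exact (if_neg hq).trans (if_neg fun h => hq (hiff.2 h)).symm
  -- If `u` and `v` were identified, they would be the ends of the edge: one order is the exempt
  -- edge, the other puts `y = u` into `S`.
  · rcases (hg _ _).1 heq with h' | ⟨h1, h2⟩ | ⟨h1, -⟩
    · exact huv h'
    · exact hne ⟨h1.symm, h2.symm⟩
    · exact hyS (h1 ▸ hS.left)

namespace Blk

/-- Contract separating edges as long as possible. -/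
def reduce : Blk := count 5 (seq search (branch (.reg 11) contract skip))

end Blk

/-! ### Exhaustive contraction. -/

theorem PCFEInstance.IsHeld.run_congr {J : PCFEInstance} {n : ℕ} {s s' : RamState}
    (h : J.IsHeld n s) (hr : ∀ q < 5, s'.reg q = s.reg q) (ha : s'.arr 0 = s.arr 0) :
    J.IsHeld n s' :=
  ⟨(hr 0 (by decide)).trans h.size, h.le, (hr 1 (by decide)).trans h.left,
    (hr 2 (by decide)).trans h.right, (hr 3 (by decide)).trans h.param,
    (hr 4 (by decide)).trans h.card, by rw [ha]; exact h.entry⟩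

/-- Each round loses a vertex or certifies that the instance is reduced; `n` lost vertices would
leave none, although `u` always remains. -/
theorem PCFEInstance.IsHeld.reduce {I : PCFEInstance} {n : ℕ} {s : RamState} (h : I.IsHeld n s)
    (hIn : I.n = n) :
    ∃ J : PCFEInstance, J.IsHeld n (Blk.reduce.run s) ∧ (I.IsYes ↔ J.IsYes) ∧ J.k = I.k ∧
      (I.u ≠ I.v → J.u ≠ J.v) ∧ J.Reduced := by
  have main := Blk.run_count_induction (r := 5)
    (p := .seq .search (.branch (.reg 11) .contract .skip)) (s := s) rfl
    (fun i s' => ∃ J : PCFEInstance, J.IsHeld n s' ∧ (I.IsYes ↔ J.IsYes) ∧ J.k = I.k ∧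
      (I.u ≠ I.v → J.u ≠ J.v) ∧ (J.Reduced ∨ J.n + i ≤ n))
    ⟨I, h.run_congr (fun q hq => by simp [hq.ne]) rfl, Iff.rfl, rfl, id, Or.inr (by omega)⟩ (by
      rintro i - s₁ - - - ⟨J, hJ, hyes, hk, huv, hred⟩
      have hJ' : J.IsHeld n (Blk.search.run s₁) := hJ.run_congr
        (fun q hq => Blk.run_reg (by
          have : ∀ q < 5, q ∉ Blk.search.regs := by decide
          exact this q hq) s₁) (Blk.run_arr (by decide) s₁)
      have harr : (Blk.search.run s₁).arr 0 = s₁.arr 0 := Blk.run_arr (by decide) s₁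
      rw [Blk.run]
      rcases Blk.run_search hJ.size hJ.left hJ.right (J.u.2.trans_le hJ.le) (J.v.2.trans_le hJ.le)
        rfl with ⟨h11, hno⟩ | ⟨h11, h12, h13, hcut⟩
      · rw [Blk.run_branch_neg (e := .reg 11) (not_not.2 h11)]
        exact ⟨J, hJ'.run_congr (fun q hq => by simp [hq.ne, Blk.run]) rfl, hyes, hk, huv,
          Or.inl (hJ.reduced hno)⟩
      · rw [Blk.run_branch_pos (e := .reg 11) h11]
        rw [← harr] at hcut
        obtain ⟨x, y, S, hx, hy, hxy, hxS, hyS, hS, hne⟩ := hcut.exists_isEdgeCut hJ' h12 h13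
        obtain ⟨J', hJ'', hyes', hk', huv', hn'⟩ :=
          hJ'.contract hx.symm hy.symm hxy hS hyS hne
        refine ⟨J', hJ''.run_congr (fun q hq => by simp [hq.ne]) rfl, hyes.trans hyes',
          hk'.trans hk, fun h => huv' (huv h), Or.inr ?_⟩
        have := hred.resolve_left fun hred => hne (hred x y S hxy hxS hyS hS)
        omega)
  rw [h.size] at main
  obtain ⟨J, hJ, hyes, hk, huv, hred⟩ := main
  refine ⟨J, hJ, hyes, hk, huv, hred.resolve_right fun hle => ?_⟩
  have := J.u.pos
  omega

/-! ### The kernel -/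

/-- The triangle with two prescribed vertices and parameter `0`. -/
def PCFEInstance.triangle : PCFEInstance where
  n := 3
  G := ⊤
  connected := SimpleGraph.connected_top
  u := 0
  v := 1
  k := 0

/-- Without contractions three levels are needed, but `u` and `v` are adjacent, so the last level is
at most `1`. -/
theorem PCFEInstance.not_isYes_triangle : ¬ PCFEInstance.triangle.IsYes := by
  rw [PCFEInstance.isYes_iff]
  rintro ⟨m, f, hf, hn⟩
  have h1 := hf.first
  have h2 := hf.last
  have h3 := hf.step (1 : Fin 3) (0 : Fin 3) (by simp [triangle])
  simp only [triangle] at h1 h2 h3 hn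
  omega

namespace Blk

/-- Replace an instance with more than `3k + 4` vertices by the triangle. -/
def replaceLarge : Blk :=
  branch (.sub (.reg 4) (.add (.add (.add (.reg 3) (.reg 3)) (.reg 3)) (.const 4)))
    (seq (fill 0 (.sub (.const 1) (.sub (.const 1) (.ne (.reg 9) (.reg 10)))))
      (seq (setReg 1 (.const 0)) (seq (setReg 2 (.const 1)) (seq (setReg 3 (.const 0))
        (setReg 4 (.const 3)))))) skip

def kernel : Blk := seq (setReg 4 (.reg 0)) (seq reduce replaceLarge)

end Blk

theorem PCFEInstance.entry_triangle {i j : ℕ} (hi : i < 3) (hj : j < 3) :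
    PCFEInstance.triangle.entry i j = 1 - (1 - (i - j + (j - i))) := by
  have hiff : (∃ a b : Fin 3, a.val = i ∧ b.val = j ∧ (⊤ : SimpleGraph (Fin 3)).Adj a b) ↔
      i ≠ j := by
    constructor
    · rintro ⟨a, b, rfl, rfl, hab⟩
      exact fun h => hab (Fin.ext h)
    · exact fun h => ⟨⟨i, hi⟩, ⟨j, hj⟩, rfl, rfl, fun h' => h (congrArg Fin.val h')⟩
  by_cases hij : i = j
  · exact (if_neg fun h => hiff.1 h hij).trans (by omega)
  · exact (if_pos (hiff.2 hij)).trans (by omega)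

/-- A reduced instance above the bound is a NO instance. It has more than four vertices, so the
triangle is no larger, and the triangle has distinct prescribed vertices. -/
theorem PCFEInstance.IsHeld.replaceLarge {J : PCFEInstance} {n : ℕ} {s : RamState}
    (h : J.IsHeld n s) (hred : J.Reduced) :
    ∃ J' : PCFEInstance,
      J'.IsOutput ((Blk.replaceLarge.run s).setReg 0 ((Blk.replaceLarge.run s).reg 4)) ∧
      (J.IsYes ↔ J'.IsYes) ∧ J'.n ≤ 3 * J.k + 4 ∧ J'.k ≤ J.k ∧ J'.n ≤ n ∧
      (J.u ≠ J.v → J'.u ≠ J'.v) := by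
  have hle := h.le
  rw [Blk.replaceLarge]
  by_cases hlarge : 3 * J.k + 4 < J.n
  · rw [Blk.run_branch_pos (by simp only [RamExpr.eval, h.card, h.param]; omega)]
    refine ⟨.triangle, ⟨rfl, rfl, rfl, rfl, fun i j hi hj => ?_⟩,
      iff_of_false (fun hyes => absurd (hyes.le_of_reduced hred) (by omega)) not_isYes_triangle,
      by simp only [triangle]; omega, Nat.zero_le _, by simp only [triangle]; omega,
      fun _ => by simp [triangle]⟩
    replace hi : i < 3 := hi
    replace hj : j < 3 := hj
    rw [entry_triangle hi hj]
    refine Blk.run_fill (T := 0) (F := fun i j => 1 - (1 - (i - j + (j - i))))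
      (fun i _ j _ s' h9 h10 _ => ?_) (by rw [h.size]; omega) (by rw [h.size]; omega)
    simp only [RamExpr.eval, RamExpr.ne, h9, h10]
  · rw [Blk.run_branch_neg (by simp only [RamExpr.eval, h.card, h.param]; omega)]
    exact ⟨J, ⟨h.card, h.left, h.right, h.param, fun i j hi hj =>
      h.entry i (hi.trans_le hle) j (hj.trans_le hle)⟩, Iff.rfl, by omega, le_rfl, hle, id⟩

theorem mainTheorem2 : ∃ p : RamProg, IsPCFEKernelization p (fun k => 3 * k + 4) := by
  -- Register `0` bounds all loops and keeps the original `n`; the new vertex count moves there from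
  -- register `4` in one last instruction, which costs the additional 2.
  refine ⟨.seq Blk.kernel.compile (.setReg 0 (.reg 4)), Blk.kernel.time + 2, fun I => ?_⟩
  obtain ⟨t, hexec, ht⟩ := Blk.exec_run (p := Blk.kernel) rfl I.input
  have hI : I.IsHeld I.n ((Blk.setReg 4 (.reg 0)).run I.input) :=
    ⟨rfl, le_rfl, rfl, rfl, rfl, rfl, fun _ _ _ _ => rfl⟩
  obtain ⟨J, hJ, hyes, hk, huv, hred⟩ := hI.reduce rfl
  obtain ⟨J', hout, hyes', hn', hk', hle, huv'⟩ := hJ.replaceLarge hred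
  refine ⟨J', _, _, .seq hexec (.setReg _ 0 (.reg 4)), ?_, hout, hyes.trans hyes', hk ▸ hn',
    hk ▸ hk', hle, fun h => huv' (huv h)⟩
  rw [Polynomial.eval_add, Polynomial.eval_ofNat]
  exact Nat.add_le_add_right ht 2
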